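/- Fix $\theta_m>0$. For $x,y,z\ge 0$ let $$p_x(y)=\frac{1}{1+\theta_m^2x}\,e^{-y/(1+\theta_m^2x)},\qquad q_x(z)=\frac{1}{1+x}\,e^{-z/(1+x)}$$ be the transition densities of the main channel $w_{Y|X}$ and of the warden's channel $w_{Z|X}$ of the (normalized) non-coherent Rayleigh-fading model, with input and output sets $[0,\infty)$. For a probability measure $\mu$ on $[0,\infty)$ let $w_{Z|X}\circ\mu$ be the law of the warden's output when the input has law $\mu$, let $I(\mu,w_{Y|X})$ be the mutual information between the input and the main channel's output, and let $\mathbb{D}(\cdot\|\cdot)$ be relative entropy. Let $\Omega$ be the set of probability measures $\mu$ on $[0,\infty)$ with $\mathbb{D}(w_{Z|X}\circ\mu\|q_0)<\infty$, and for $\nu>0$ put $$A(\nu)=\sup\{I(\mu,w_{Y|X}) : \mu\in\Omega,\ \mathbb{D}(w_{Z|X}\circ\mu\|q_0)\le\nu\}.$$ Then there exists $\nu_0>0$ such that for every $0<\nu<\nu_0$ there is exactly one $\mu^*_\nu\in\Omega$ with $\mathbb{D}(w_{Z|X}\circ\mu^*_\nu\|q_0)\le\nu$ and $I(\mu^*_\nu,w_{Y|X})=A(\nu)$,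 and this optimal input has a mass point at $0$: $\mu^*_\nu(\{0\})>0$. -/

import Mathlib

open MeasureTheory ProbabilityTheory InformationTheory
open scoped NNReal ENNReal

namespace CovertRayleigh

/-- The transition density `(1 / (θ² x + 1)) * exp (-y / (θ² x + 1))` of the non-coherent
Rayleigh-fading channel with fading parameter `θ` and unit noise variance, for an input `x ≥ 0`
(a squared amplitude) and an output `y ≥ 0`. -/
noncomputable def transitionDensity (θ : ℝ) (x : ℝ≥0) (y : ℝ) : ℝ :=
  1 / (θ ^ 2 * (x : ℝ) + 1) * Real.exp (-y / (θ ^ 2 * (x : ℝ) + 1))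

/-- The output law for the input `x`: it is carried by `[0, ∞)` and has the density
`transitionDensity θ x` there. -/
noncomputable def outputLaw (θ : ℝ) (x : ℝ≥0) : Measure ℝ :=
  (volume.restrict (Set.Ici (0 : ℝ))).withDensity
    fun y => ENNReal.ofReal (transitionDensity θ x y)

theorem measurable_transitionDensity (θ : ℝ) :
    Measurable (Function.uncurry (transitionDensity θ)) := by
  unfold transitionDensity Function.uncurry
  fun_prop

theorem measurable_outputLaw (θ : ℝ) : Measurable (outputLaw θ) := by
  refine Measure.measurable_of_measurable_coe _ fun s hs => ?_
  have h : (fun x => outputLaw θ x s) = fun x => ∫⁻ y,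
      ENNReal.ofReal (transitionDensity θ x y) ∂((volume.restrict (Set.Ici (0 : ℝ))).restrict s) :=
    funext fun x => withDensity_apply _ hs
  rw [h]
  exact Measurable.lintegral_prod_right (measurable_transitionDensity θ).ennreal_ofReal

theorem outputLaw_eq_expMeasure (θ : ℝ) (x : ℝ≥0) :
    outputLaw θ x = expMeasure (1 / (θ ^ 2 * (x : ℝ) + 1)) := by
  unfold outputLaw expMeasure gammaMeasure
  rw [← withDensity_indicator measurableSet_Ici]
  congr 1
  funext y
  by_cases hy : 0 ≤ y
  · have h := exponentialPDF_of_nonneg (r := 1 / (θ ^ 2 * (x : ℝ) + 1)) hy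
    rw [Set.indicator_of_mem (Set.mem_Ici.2 hy)]
    refine Eq.trans ?_ h.symm
    unfold transitionDensity
    congr 3
    ring
  · rw [Set.indicator_of_notMem (by simpa using hy)]
    exact (gammaPDF_of_neg (not_le.1 hy)).symm

/-- The memoryless channel with input set `[0, ∞)` and fading parameter `θ`. -/
noncomputable def channel (θ : ℝ) : Kernel ℝ≥0 ℝ where
  toFun := outputLaw θ
  measurable' := measurable_outputLaw θ

instance (θ : ℝ) : IsMarkovKernel (channel θ) where
  isProbabilityMeasure x := by
    change IsProbabilityMeasure (outputLaw θ x)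
    rw [outputLaw_eq_expMeasure]
    exact isProbabilityMeasure_expMeasure (by positivity)

/-- The warden's channel, whose fading parameter is normalized to `1`. -/
noncomputable def wardenChannel : Kernel ℝ≥0 ℝ := channel 1

/-- The mutual information between the input, distributed as `μ`, and the output of the channel `w`:
the relative entropy between the joint law and the product of its marginals. -/
noncomputable def mutualInfo (μ : Measure ℝ≥0) (w : Kernel ℝ≥0 ℝ) : ℝ≥0∞ :=
  klDiv (μ ⊗ₘ w) (μ.prod (w ∘ₘ μ))

/-- The relative entropy between the warden's output law for the random input `μ` and the warden's
output law for the constant input `0`. -/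
noncomputable def wardenDiv (μ : Measure ℝ≥0) : ℝ≥0∞ :=
  klDiv (wardenChannel ∘ₘ μ) (wardenChannel 0)

/-- The probability measures on `[0, ∞)` with finite warden divergence. -/
def inputLaws : Set (Measure ℝ≥0) :=
  {μ | IsProbabilityMeasure μ ∧ wardenDiv μ < ∞}

/-- The input laws that satisfy the covertness constraint at level `ν`. -/
def feasible (ν : ℝ) : Set (Measure ℝ≥0) :=
  {μ | μ ∈ inputLaws ∧ wardenDiv μ ≤ ENNReal.ofReal ν}

/-- The largest mutual information over the main channel under the covertness constraint. -/
noncomputable def covertValue (θ ν : ℝ) : ℝ≥0∞ :=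
  ⨆ μ ∈ feasible ν, mutualInfo μ (channel θ)

/-- `μ` is an optimal input law at level `ν`. -/
def IsOptimalInput (θ ν : ℝ) (μ : Measure ℝ≥0) : Prop :=
  μ ∈ feasible ν ∧ mutualInfo μ (channel θ) = covertValue θ ν

end CovertRayleigh

/-! Write `b = θ ^ 2`. The basic tool is the compensation identity `mutualInfo_add_outDiv`:
information plus output divergence from a reference input is linear in the input law. Finite warden
divergence forces a finite mean (`lintegral_coe_le`), so with reference `0` the information of a
feasible law is the real number `∫ expDiv (b * x) ∂μ - realDiv b μ`, linear minus convex.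

Uniqueness: `realDiv b` is strictly convex at midpoints, because the output density determines the
input law (`eq_of_outDens_eq`).

Existence: feasible laws have bounded mean, hence are tight, and the constraint is lower
semicontinuous. The mean is not weakly continuous, so the information could be lost to mass escaping
to infinity. With reference input `x₀` the mean enters with coefficient `b / (1 + b * x₀)`, which
vanishes as `x₀` grows (`le_mutualInfo_add_of_tendsto`).

Mass at `0`: put `ν = r ^ 6`. A feasible law has mean `O(r ^ 3)`, only `O(r ^ 4)` of it beyond `3`
(`integral_coe_le`, `setIntegral_Ioi_three_le`), while the optimum carries information at least `c *
r ^ 3` (`exists_le_realInfo_of_isOptimalInput`). Suppose an optimal `μ` has no atom at `0`, and let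
`m > 0` be the integral of `x` over `[0, δ]`. Collapsing `[0, δ]` to `0` costs at most `b ^ 2 * δ /
2 * m` of information, a second-order effect in `x`. It lowers the warden's divergence by order `m *
r ^ 3`, a first-order effect (`realDiv_thin_add_mul_le`). This slack allows the rest of the law to
be enlarged by a factor `1 + β` with `β` of order `m / r ^ 3` (`realDiv_thin_le`), which gains a
multiple of `m` whose coefficient does not depend on `δ`. For small `δ` the gain exceeds the cost,
contradicting optimality. -/

namespace CovertRayleigh

variable {b : ℝ}

/-! ### The unit exponential law, likelihood ratios and output densities. -/

/-- The exponential law with mean `1`, which is the output law for the input `0`. -/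
noncomputable def unitExp : Measure ℝ := expMeasure 1

instance : IsProbabilityMeasure unitExp := isProbabilityMeasure_expMeasure one_pos

theorem unitExp_eq_withDensity :
    unitExp = (volume.restrict (Set.Ici (0 : ℝ))).withDensity
      fun y => ENNReal.ofReal (Real.exp (-y)) := by
  have h := outputLaw_eq_expMeasure 0 0
  simp only [NNReal.coe_zero, mul_zero, zero_add, div_one] at h
  rw [unitExp, ← h]
  unfold outputLaw transitionDensity
  simp

theorem outputLaw_zero (θ : ℝ) : outputLaw θ 0 = unitExp := by
  rw [outputLaw_eq_expMeasure]
  simp [unitExp]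

theorem channel_zero (θ : ℝ) : channel θ 0 = unitExp := outputLaw_zero θ

theorem ae_nonneg_unitExp : ∀ᵐ y ∂unitExp, 0 ≤ y := by
  rw [unitExp_eq_withDensity]
  exact (withDensity_absolutelyContinuous _ _).ae_le (ae_restrict_mem measurableSet_Ici)

theorem volume_restrict_absolutelyContinuous_unitExp :
    volume.restrict (Set.Ici (0 : ℝ)) ≪ unitExp := by
  rw [unitExp_eq_withDensity]
  refine withDensity_absolutelyContinuous' (by fun_prop) (Filter.Eventually.of_forall fun y => ?_)
  simp [Real.exp_pos]

theorem integral_unitExp (f : ℝ → ℝ) :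
    ∫ y, f y ∂unitExp = ∫ y in Set.Ioi 0, Real.exp (-y) * f y := by
  rw [unitExp_eq_withDensity, integral_withDensity_eq_integral_toReal_smul (by fun_prop)
    (Filter.Eventually.of_forall fun _ => ENNReal.ofReal_lt_top),
    Measure.restrict_congr_set Ioi_ae_eq_Ici.symm]
  simp [ENNReal.toReal_ofReal (Real.exp_pos _).le]

theorem integrable_unitExp_iff (f : ℝ → ℝ) :
    Integrable f unitExp ↔ IntegrableOn (fun y => Real.exp (-y) * f y) (Set.Ioi 0) := by
  rw [unitExp_eq_withDensity, integrable_withDensity_iff_integrable_smul' (by fun_prop)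
    (Filter.Eventually.of_forall fun _ => ENNReal.ofReal_lt_top),
    Measure.restrict_congr_set Ioi_ae_eq_Ici.symm]
  simp [ENNReal.toReal_ofReal (Real.exp_pos _).le, IntegrableOn]

theorem integrable_exp_mul_unitExp {c : ℝ} (hc : c < 1) :
    Integrable (fun y => Real.exp (c * y)) unitExp := by
  rw [integrable_unitExp_iff]
  have := integrableOn_exp_mul_Ioi (a := c - 1) (by linarith) 0
  refine this.congr_fun (fun y _ => ?_) measurableSet_Ioi
  simp only [← Real.exp_add]
  ring_nf

theorem integral_exp_mul_unitExp {c : ℝ} (hc : c < 1) :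
    ∫ y, Real.exp (c * y) ∂unitExp = 1 / (1 - c) := by
  have := integral_exp_mul_Ioi (a := c - 1) (by linarith) 0
  rw [integral_unitExp]
  have h : ∀ y : ℝ, Real.exp (-y) * Real.exp (c * y) = Real.exp ((c - 1) * y) := fun y => by
    rw [← Real.exp_add]; ring_nf
  simp only [h, this, mul_zero, Real.exp_zero]
  rw [← neg_sub 1 c, neg_div_neg_eq]

theorem integrable_id_unitExp : Integrable (fun y : ℝ => y) unitExp := by
  refine ((integrable_exp_mul_unitExp (c := 1 / 2) (by norm_num)).const_mul 2).mono'
    (by fun_prop) ?_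
  filter_upwards [ae_nonneg_unitExp] with y hy
  rw [Real.norm_of_nonneg hy]
  linarith [Real.add_one_le_exp (1 / 2 * y)]

theorem integral_mul_exp_neg_mul {r : ℝ} (hr : 0 < r) :
    ∫ y in Set.Ioi (0 : ℝ), y * Real.exp (-(r * y)) = (1 / r) ^ 2 := by
  have := Real.integral_rpow_mul_exp_neg_mul_Ioi (a := 2) (r := r) (by norm_num) hr
  norm_num at this
  simpa using this

theorem integral_id_unitExp : ∫ y, y ∂unitExp = 1 := by
  rw [integral_unitExp, ← one_pow (M := ℝ) 2, ← div_one (1 : ℝ), ← integral_mul_exp_neg_mul one_pos]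
  simp [mul_comm]

theorem integral_mul_exp_neg_unitExp : ∫ y, y * Real.exp (-y) ∂unitExp = 1 / 4 := by
  have := integral_mul_exp_neg_mul (r := 2) (by norm_num)
  rw [integral_unitExp]
  norm_num at this ⊢
  rw [← this]
  congr 1
  funext y
  rw [mul_left_comm, ← Real.exp_add]
  ring_nf

/-- The channel rescales a unit exponential variable, which is checked on distribution functions.
Integrals against any output law thereby become integrals against `unitExp`. -/
theorem outputLaw_eq_map (θ : ℝ) (x : ℝ≥0) :
    outputLaw θ x = unitExp.map fun u => (1 + θ ^ 2 * x) * u := by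
  have hc : 0 < 1 + θ ^ 2 * (x : ℝ) := by positivity
  have hr : 0 < 1 / (θ ^ 2 * (x : ℝ) + 1) := by positivity
  have hm : Measurable fun u : ℝ => (1 + θ ^ 2 * (x : ℝ)) * u := by fun_prop
  have := isProbabilityMeasure_expMeasure hr
  have : IsProbabilityMeasure (unitExp.map fun u => (1 + θ ^ 2 * (x : ℝ)) * u) :=
    Measure.isProbabilityMeasure_map hm.aemeasurable
  rw [outputLaw_eq_expMeasure]
  refine Measure.eq_of_cdf _ _ ?_
  ext t
  rw [cdf_expMeasure_eq hr, cdf_eq_real, map_measureReal_apply hm measurableSet_Iic]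
  have h1 : (fun u : ℝ => (1 + θ ^ 2 * (x : ℝ)) * u) ⁻¹' Set.Iic t
      = Set.Iic (t / (1 + θ ^ 2 * (x : ℝ))) := by
    ext u
    rw [Set.mem_preimage, Set.mem_Iic, Set.mem_Iic, le_div_iff₀ hc, mul_comm]
  rw [h1, ← cdf_eq_real, unitExp, cdf_expMeasure_eq one_pos]
  have h2 : 0 ≤ t / (1 + θ ^ 2 * (x : ℝ)) ↔ 0 ≤ t :=
    ⟨fun h => by simpa [div_mul_cancel₀ _ hc.ne'] using mul_nonneg h hc.le,
      fun h => div_nonneg h hc.le⟩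
  simp only [h2]
  congr 4
  field_simp
  ring

/-- The density of the output law for the input `x` with respect to that for the input `0`, on a
channel with gain `b`. -/
noncomputable def lik (b : ℝ) (x : ℝ≥0) (y : ℝ) : ℝ :=
  1 / (1 + b * x) * Real.exp (y * (b * x / (1 + b * x)))

theorem measurable_lik (b : ℝ) : Measurable (Function.uncurry (lik b)) := by
  unfold lik Function.uncurry
  fun_prop

@[fun_prop]
theorem measurable_lik_left (b y : ℝ) : Measurable fun x => lik b x y :=
  (measurable_lik b).of_uncurry_right

@[fun_prop]
theorem measurable_lik_right (b : ℝ) (x : ℝ≥0) : Measurable (lik b x) :=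
  (measurable_lik b).of_uncurry_left

theorem one_add_mul_pos (hb : 0 ≤ b) (x : ℝ≥0) : 0 < 1 + b * x := by positivity

theorem lik_pos (hb : 0 ≤ b) (x : ℝ≥0) (y : ℝ) : 0 < lik b x y := by
  have := one_add_mul_pos hb x
  unfold lik
  positivity

theorem lik_zero (b y : ℝ) : lik b 0 y = 1 := by simp [lik]

theorem slope_nonneg (hb : 0 ≤ b) (x : ℝ≥0) : 0 ≤ b * x / (1 + b * x) := by positivity

theorem slope_lt_one (hb : 0 ≤ b) (x : ℝ≥0) : b * x / (1 + b * x) < 1 := by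
  rw [div_lt_one (one_add_mul_pos hb x)]
  linarith

theorem lik_le_exp_abs (hb : 0 ≤ b) (x : ℝ≥0) (y : ℝ) : lik b x y ≤ Real.exp |y| := by
  have h1 : 1 / (1 + b * (x : ℝ)) ≤ 1 := by
    rw [div_le_one (one_add_mul_pos hb x)]
    have : 0 ≤ b * (x : ℝ) := by positivity
    linarith
  have h2 : y * (b * x / (1 + b * x)) ≤ |y| := by
    calc y * (b * x / (1 + b * x)) ≤ |y| * (b * x / (1 + b * x)) :=
          mul_le_mul_of_nonneg_right (le_abs_self y) (slope_nonneg hb x)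
      _ ≤ |y| * 1 := mul_le_mul_of_nonneg_left (slope_lt_one hb x).le (abs_nonneg y)
      _ = |y| := mul_one _
  calc lik b x y ≤ 1 * Real.exp (y * (b * x / (1 + b * x))) :=
        mul_le_mul_of_nonneg_right h1 (Real.exp_pos _).le
    _ ≤ Real.exp |y| := by rw [one_mul]; exact Real.exp_le_exp.2 h2

theorem continuous_lik (hb : 0 ≤ b) : Continuous (Function.uncurry (lik b)) := by
  unfold lik Function.uncurry
  have : ∀ p : ℝ≥0 × ℝ, 1 + b * (p.1 : ℝ) ≠ 0 := fun p => (one_add_mul_pos hb p.1).ne'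
  fun_prop (disch := exact this _)

theorem continuous_lik_left (hb : 0 ≤ b) (y : ℝ) : Continuous fun x => lik b x y :=
  (continuous_lik hb).comp (by fun_prop : Continuous fun x : ℝ≥0 => (x, y))

theorem continuous_lik_right (hb : 0 ≤ b) (x : ℝ≥0) : Continuous (lik b x) :=
  (continuous_lik hb).comp (by fun_prop : Continuous fun y : ℝ => (x, y))

theorem outputLaw_eq_withDensity (θ : ℝ) (x : ℝ≥0) :
    outputLaw θ x = unitExp.withDensity fun y => ENNReal.ofReal (lik (θ ^ 2) x y) := by
  rw [unitExp_eq_withDensity, ← withDensity_mul _ (by fun_prop) (by fun_prop)]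
  unfold outputLaw
  congr 1
  funext y
  rw [Pi.mul_apply, ← ENNReal.ofReal_mul (Real.exp_pos _).le, lik, mul_left_comm, ← Real.exp_add,
    transitionDensity, add_comm 1]
  congr 3
  have : 0 < θ ^ 2 * (x : ℝ) + 1 := by positivity
  field_simp
  ring

theorem channel_apply (θ : ℝ) (x : ℝ≥0) : channel θ x = outputLaw θ x := rfl

theorem integrable_lik (hb : 0 ≤ b) (μ : Measure ℝ≥0) [IsFiniteMeasure μ] (y : ℝ) :
    Integrable (fun x => lik b x y) μ := by
  refine Integrable.of_bound (by fun_prop) (Real.exp |y|) (Filter.Eventually.of_forall fun x => ?_)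
  rw [Real.norm_of_nonneg (lik_pos hb x y).le]
  exact lik_le_exp_abs hb x y

/-- The density of the output law for the input law `μ` with respect to that for the input `0`. -/
noncomputable def outDens (b : ℝ) (μ : Measure ℝ≥0) (y : ℝ) : ℝ := ∫ x, lik b x y ∂μ

@[fun_prop]
theorem measurable_outDens (b : ℝ) (μ : Measure ℝ≥0) [SFinite μ] : Measurable (outDens b μ) :=
  (measurable_lik b).stronglyMeasurable.integral_prod_left.measurable

theorem ofReal_outDens (hb : 0 ≤ b) (μ : Measure ℝ≥0) [IsFiniteMeasure μ] (y : ℝ) :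
    ENNReal.ofReal (outDens b μ y) = ∫⁻ x, ENNReal.ofReal (lik b x y) ∂μ :=
  ofReal_integral_eq_lintegral_ofReal (integrable_lik hb μ y)
    (Filter.Eventually.of_forall fun x => (lik_pos hb x y).le)

theorem outDens_nonneg (hb : 0 ≤ b) (μ : Measure ℝ≥0) (y : ℝ) : 0 ≤ outDens b μ y :=
  integral_nonneg fun x => (lik_pos hb x y).le

theorem outDens_pos (hb : 0 ≤ b) (μ : Measure ℝ≥0) [IsProbabilityMeasure μ] (y : ℝ) :
    0 < outDens b μ y := by
  refine (integral_pos_iff_support_of_nonneg (fun x => (lik_pos hb x y).le)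
    (integrable_lik hb μ y)).2 ?_
  have : Function.support (fun x => lik b x y) = Set.univ := by
    ext x; simp [(lik_pos hb x y).ne']
  simp [this]

theorem continuous_outDens (hb : 0 ≤ b) (μ : Measure ℝ≥0) [IsFiniteMeasure μ] :
    Continuous (outDens b μ) := by
  refine continuous_iff_continuousAt.2 fun y₀ => ?_
  refine continuousAt_of_dominated (F := fun y x => lik b x y)
    (bound := fun _ => Real.exp (|y₀| + 1)) ?_ ?_ (integrable_const _) ?_
  · exact Filter.Eventually.of_forall fun y => by fun_prop
  · have : ∀ᶠ y in nhds y₀, |y| < |y₀| + 1 :=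
      (continuous_abs.tendsto y₀).eventually (gt_mem_nhds (by linarith))
    filter_upwards [this] with y hy
    refine Filter.Eventually.of_forall fun x => ?_
    rw [Real.norm_of_nonneg (lik_pos hb x y).le]
    exact (lik_le_exp_abs hb x y).trans (Real.exp_le_exp.2 hy.le)
  · exact Filter.Eventually.of_forall fun x => (continuous_lik_right hb x).continuousAt

theorem channel_comp_eq_withDensity (θ : ℝ) (μ : Measure ℝ≥0) [IsFiniteMeasure μ] :
    channel θ ∘ₘ μ = unitExp.withDensity fun y => ENNReal.ofReal (outDens (θ ^ 2) μ y) := by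
  ext s hs
  rw [Measure.bind_apply hs (channel θ).aemeasurable, withDensity_apply _ hs]
  simp_rw [channel_apply, outputLaw_eq_withDensity, withDensity_apply _ hs,
    ofReal_outDens (sq_nonneg θ)]
  exact lintegral_lintegral_swap (measurable_lik _).ennreal_ofReal.aemeasurable

/-! ### Relative entropies as integrals, and the compensation identity. -/

theorem klDiv_withDensity_left {α : Type*} [MeasurableSpace α] (ρ : Measure α) [SigmaFinite ρ]
    {f : α → ℝ≥0∞} (hf : Measurable f) [IsFiniteMeasure ρ] [IsFiniteMeasure (ρ.withDensity f)] :
    klDiv (ρ.withDensity f) ρ = ∫⁻ x, ENNReal.ofReal (klFun (f x).toReal) ∂ρ := by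
  rw [klDiv_eq_lintegral_klFun_of_ac (withDensity_absolutelyContinuous _ _)]
  refine lintegral_congr_ae ?_
  filter_upwards [Measure.rnDeriv_withDensity ρ hf] with x hx
  rw [hx]

theorem klDiv_withDensity_ofReal {α : Type*} [MeasurableSpace α] (ρ : Measure α)
    [IsFiniteMeasure ρ] {f g : α → ℝ} (hf : Measurable f) (hg : Measurable g) (hf0 : ∀ x, 0 ≤ f x)
    (hg0 : ∀ x, 0 < g x) [IsFiniteMeasure (ρ.withDensity fun x => ENNReal.ofReal (f x))]
    [IsFiniteMeasure (ρ.withDensity fun x => ENNReal.ofReal (g x))] :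
    klDiv (ρ.withDensity fun x => ENNReal.ofReal (f x))
        (ρ.withDensity fun x => ENNReal.ofReal (g x))
      = ∫⁻ x, ENNReal.ofReal (g x * klFun (f x / g x)) ∂ρ := by
  have h : (ρ.withDensity fun x => ENNReal.ofReal (f x))
      = (ρ.withDensity fun x => ENNReal.ofReal (g x)).withDensity
        fun x => ENNReal.ofReal (f x / g x) := by
    rw [← withDensity_mul _ (by fun_prop) (by fun_prop)]
    congr 1
    funext x
    rw [Pi.mul_apply, ← ENNReal.ofReal_mul (hg0 x).le, mul_div_cancel₀ _ (hg0 x).ne']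
  have : IsFiniteMeasure ((ρ.withDensity fun x => ENNReal.ofReal (g x)).withDensity
        fun x => ENNReal.ofReal (f x / g x)) := h ▸ inferInstance
  rw [h, klDiv_withDensity_left _ (by fun_prop), lintegral_withDensity_eq_lintegral_mul _
    (by fun_prop) (by fun_prop)]
  refine lintegral_congr fun x => ?_
  rw [Pi.mul_apply, ← ENNReal.ofReal_mul (hg0 x).le,
    ENNReal.toReal_ofReal (div_nonneg (hf0 x) (hg0 x).le)]

theorem withDensity_lik (hb : 0 ≤ b) (x : ℝ≥0) :
    (unitExp.withDensity fun y => ENNReal.ofReal (lik b x y))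
      = unitExp.map fun u => (1 + b * x) * u := by
  have h := outputLaw_eq_withDensity (√b) x
  rw [outputLaw_eq_map, Real.sq_sqrt hb] at h
  exact h.symm

theorem integral_mul_lik (hb : 0 ≤ b) (x : ℝ≥0) {f : ℝ → ℝ} (hf : Measurable f) :
    ∫ y, f y * lik b x y ∂unitExp = ∫ u, f ((1 + b * x) * u) ∂unitExp := by
  rw [← integral_map (φ := fun u => (1 + b * x) * u) (by fun_prop)
    hf.aestronglyMeasurable, ← withDensity_lik hb,
    integral_withDensity_eq_integral_toReal_smul (by fun_prop)
    (Filter.Eventually.of_forall fun _ => ENNReal.ofReal_lt_top)]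
  simp [ENNReal.toReal_ofReal (lik_pos hb x _).le, mul_comm]

theorem integrable_mul_lik_iff (hb : 0 ≤ b) (x : ℝ≥0) {f : ℝ → ℝ} (hf : Measurable f) :
    Integrable (fun y => f y * lik b x y) unitExp
      ↔ Integrable (fun u => f ((1 + b * x) * u)) unitExp := by
  have h := integrable_map_measure (μ := unitExp) (f := fun u => (1 + b * x) * u)
    hf.aestronglyMeasurable (by fun_prop)
  rw [← withDensity_lik hb, integrable_withDensity_iff_integrable_smul' (by fun_prop)
    (Filter.Eventually.of_forall fun _ => ENNReal.ofReal_lt_top)] at h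
  simpa [ENNReal.toReal_ofReal (lik_pos hb x _).le, mul_comm, Function.comp_def] using h

theorem lintegral_mul_lik (hb : 0 ≤ b) (x : ℝ≥0) {f : ℝ → ℝ≥0∞} (hf : Measurable f) :
    ∫⁻ y, f y * ENNReal.ofReal (lik b x y) ∂unitExp = ∫⁻ u, f ((1 + b * x) * u) ∂unitExp := by
  rw [← lintegral_map hf (by fun_prop : Measurable fun u : ℝ => (1 + b * x) * u),
    ← withDensity_lik hb, lintegral_withDensity_eq_lintegral_mul _ (by fun_prop) hf]
  simp [mul_comm]

theorem integrable_lik_unitExp (hb : 0 ≤ b) (x : ℝ≥0) : Integrable (lik b x) unitExp := by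
  simpa using (integrable_mul_lik_iff hb x (f := fun _ => 1) measurable_const).2
    (integrable_const _)

theorem integral_lik_unitExp (hb : 0 ≤ b) (x : ℝ≥0) : ∫ y, lik b x y ∂unitExp = 1 := by
  simpa using integral_mul_lik hb x (f := fun _ => 1) measurable_const

theorem integrable_id_mul_lik (hb : 0 ≤ b) (x : ℝ≥0) :
    Integrable (fun y => y * lik b x y) unitExp :=
  (integrable_mul_lik_iff hb x measurable_id).2 (integrable_id_unitExp.const_mul _)

theorem integral_id_mul_lik (hb : 0 ≤ b) (x : ℝ≥0) :
    ∫ y, y * lik b x y ∂unitExp = 1 + b * x := by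
  rw [integral_mul_lik hb x (f := fun y => y) measurable_id, integral_const_mul,
    integral_id_unitExp, mul_one]

theorem mul_klFun_div {c f : ℝ} (hc : 0 < c) (hf : 0 < f) :
    c * klFun (f / c) = f * Real.log f - f * Real.log c + c - f := by
  rw [klFun_apply, Real.log_div hf.ne' hc.ne']
  field_simp

theorem log_lik (hb : 0 ≤ b) (x : ℝ≥0) (y : ℝ) :
    Real.log (lik b x y) = y * (b * x / (1 + b * x)) - Real.log (1 + b * x) := by
  have := one_add_mul_pos hb x
  rw [lik, Real.log_mul (by positivity) (Real.exp_pos _).ne', Real.log_exp, one_div, Real.log_inv]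
  ring

/-- The log-likelihood ratio is affine in `y`, so only the total mass and the mean of an exponential
law enter. -/
theorem lintegral_klFun_lik (hb : 0 ≤ b) (x₀ x : ℝ≥0) :
    ∫⁻ y, ENNReal.ofReal (lik b x₀ y * klFun (lik b x y / lik b x₀ y)) ∂unitExp
      = ENNReal.ofReal ((1 + b * x) / (1 + b * x₀) - 1 + Real.log (1 + b * x₀)
          - Real.log (1 + b * x)) := by
  have hx := one_add_mul_pos hb x
  have hx₀ := one_add_mul_pos hb x₀
  have h : ∀ y, lik b x₀ y * klFun (lik b x y / lik b x₀ y)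
      = (b * x / (1 + b * x) - b * x₀ / (1 + b * x₀)) * (y * lik b x y)
        + (Real.log (1 + b * x₀) - Real.log (1 + b * x) - 1) * lik b x y + lik b x₀ y := fun y => by
    rw [mul_klFun_div (lik_pos hb x₀ y) (lik_pos hb x y), log_lik hb, log_lik hb]
    ring
  have i1 := (integrable_id_mul_lik hb x).const_mul
    (b * x / (1 + b * x) - b * x₀ / (1 + b * x₀))
  have i2 := (integrable_lik_unitExp hb x).const_mul
    (Real.log (1 + b * x₀) - Real.log (1 + b * x) - 1)
  have i3 := integrable_lik_unitExp hb x₀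
  have i12 : Integrable (fun y => (b * x / (1 + b * x) - b * x₀ / (1 + b * x₀))
      * (y * lik b x y) + (Real.log (1 + b * x₀) - Real.log (1 + b * x) - 1) * lik b x y) unitExp :=
    i1.add i2
  rw [← ofReal_integral_eq_lintegral_ofReal]
  · congr 1
    simp only [h]
    rw [integral_add i12 i3, integral_add i1 i2, integral_const_mul, integral_const_mul,
      integral_id_mul_lik hb, integral_lik_unitExp hb, integral_lik_unitExp hb]
    field_simp
    ring
  · simp only [h]
    exact i12.add i3
  · exact Filter.Eventually.of_forall fun y => mul_nonneg (lik_pos hb x₀ y).le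
      (klFun_nonneg (div_nonneg (lik_pos hb x y).le (lik_pos hb x₀ y).le))

/-- A Bregman identity: the integrands on the two sides differ by an affine function of `f x`, whose
integral depends only on the mean `G`. -/
theorem lintegral_klFun_compensation {α : Type*} [MeasurableSpace α] (μ : Measure α)
    [IsProbabilityMeasure μ] {f : α → ℝ} (hf : Measurable f) {C : ℝ} (hf0 : ∀ x, 0 < f x)
    (hfC : ∀ x, f x ≤ C) {G : ℝ} (hG : G = ∫ x, f x ∂μ) (hG0 : 0 < G) {r : ℝ} (hr : 0 < r) :
    ∫⁻ x, ENNReal.ofReal (G * klFun (f x / G)) ∂μ + ENNReal.ofReal (r * klFun (G / r))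
      = ∫⁻ x, ENNReal.ofReal (r * klFun (f x / r)) ∂μ := by
  have hint : Integrable f μ := Integrable.of_bound hf.aestronglyMeasurable C
    (Filter.Eventually.of_forall fun x => by rw [Real.norm_of_nonneg (hf0 x).le]; exact hfC x)
  have hkl : ∀ c : ℝ, 0 < c → Integrable (fun x => c * klFun (f x / c)) μ := fun c hc => by
    obtain ⟨K, hK⟩ := (isCompact_Icc (a := 0) (b := C / c)).exists_bound_of_continuousOn
      continuous_klFun.continuousOn
    refine (Integrable.of_bound (by fun_prop) K (Filter.Eventually.of_forall fun x => ?_)).const_mul c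
    exact hK _ ⟨div_nonneg (hf0 x).le hc.le, div_le_div_of_nonneg_right (hfC x) hc.le⟩
  have hnn : ∀ c : ℝ, 0 < c → ∀ x, 0 ≤ c * klFun (f x / c) := fun c hc x =>
    mul_nonneg hc.le (klFun_nonneg (div_nonneg (hf0 x).le hc.le))
  have hrG : 0 ≤ r * klFun (G / r) := mul_nonneg hr.le (klFun_nonneg (div_nonneg hG0.le hr.le))
  rw [← ofReal_integral_eq_lintegral_ofReal (hkl G hG0) (Filter.Eventually.of_forall (hnn G hG0)),
    ← ofReal_integral_eq_lintegral_ofReal (hkl r hr) (Filter.Eventually.of_forall (hnn r hr)),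
    ← ENNReal.ofReal_add (integral_nonneg (hnn G hG0)) hrG]
  congr 1
  have h : ∀ x, r * klFun (f x / r) = G * klFun (f x / G)
      + ((Real.log G - Real.log r) * f x + (r - G)) := fun x => by
    rw [mul_klFun_div hr (hf0 x), mul_klFun_div hG0 (hf0 x)]
    ring
  simp only [h]
  have i2 : Integrable (fun x => (Real.log G - Real.log r) * f x + (r - G)) μ :=
    (hint.const_mul _).add (integrable_const _)
  rw [integral_add (hkl G hG0) i2, integral_add (hint.const_mul _) (integrable_const _), integral_const_mul _ f, ← hG,
    mul_klFun_div hr hG0]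
  simp
  ring

theorem compProd_channel (θ : ℝ) (μ : Measure ℝ≥0) [IsFiniteMeasure μ] :
    μ ⊗ₘ channel θ = (μ.prod unitExp).withDensity
      fun p => ENNReal.ofReal (lik (θ ^ 2) p.1 p.2) := by
  have hm : Measurable fun p : ℝ≥0 × ℝ => ENNReal.ofReal (lik (θ ^ 2) p.1 p.2) :=
    (measurable_lik (θ ^ 2)).ennreal_ofReal
  ext s hs
  rw [Measure.compProd_apply hs, withDensity_apply _ hs, ← lintegral_indicator hs,
    lintegral_prod _ (hm.indicator hs).aemeasurable]
  refine lintegral_congr fun x => ?_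
  have hs' := measurable_prodMk_left (x := x) hs
  rw [channel_apply, outputLaw_eq_withDensity, withDensity_apply _ hs', ← lintegral_indicator hs']
  rfl

theorem prod_channel_comp (θ : ℝ) (μ : Measure ℝ≥0) [IsFiniteMeasure μ] :
    μ.prod (channel θ ∘ₘ μ) = (μ.prod unitExp).withDensity
      fun p => ENNReal.ofReal (outDens (θ ^ 2) μ p.2) := by
  have hm : Measurable fun p : ℝ≥0 × ℝ => ENNReal.ofReal (outDens (θ ^ 2) μ p.2) := by fun_prop
  ext s hs
  rw [Measure.prod_apply hs, withDensity_apply _ hs, ← lintegral_indicator hs,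
    lintegral_prod _ (hm.indicator hs).aemeasurable]
  refine lintegral_congr fun x => ?_
  have hs' := measurable_prodMk_left (x := x) hs
  rw [channel_comp_eq_withDensity, withDensity_apply _ hs', ← lintegral_indicator hs']
  rfl

theorem mutualInfo_eq_lintegral (θ : ℝ) (μ : Measure ℝ≥0) [IsProbabilityMeasure μ] :
    mutualInfo μ (channel θ) = ∫⁻ x, ∫⁻ y, ENNReal.ofReal (outDens (θ ^ 2) μ y
      * klFun (lik (θ ^ 2) x y / outDens (θ ^ 2) μ y)) ∂unitExp ∂μ := by
  have hb := sq_nonneg θ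
  have h1 := compProd_channel θ μ
  have h2 := prod_channel_comp θ μ
  have f1 : IsFiniteMeasure ((μ.prod unitExp).withDensity
      fun p => ENNReal.ofReal (lik (θ ^ 2) p.1 p.2)) := h1 ▸ inferInstance
  have f2 : IsFiniteMeasure ((μ.prod unitExp).withDensity
      fun p => ENNReal.ofReal (outDens (θ ^ 2) μ p.2)) := h2 ▸ inferInstance
  have m1 : Measurable fun p : ℝ≥0 × ℝ => lik (θ ^ 2) p.1 p.2 := measurable_lik _
  have m2 : Measurable fun p : ℝ≥0 × ℝ => outDens (θ ^ 2) μ p.2 := by fun_prop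
  rw [mutualInfo, h1, h2, klDiv_withDensity_ofReal _ m1 m2 (fun p => (lik_pos hb _ _).le)
    (fun p => outDens_pos hb μ _), lintegral_prod _ (by fun_prop)]

/-- The relative entropy of the output law for the input law `μ` with respect to that for the
constant input `x₀`, on a channel with gain `b`. -/
noncomputable def outDiv (b : ℝ) (x₀ : ℝ≥0) (μ : Measure ℝ≥0) : ℝ≥0∞ :=
  ∫⁻ y, ENNReal.ofReal (lik b x₀ y * klFun (outDens b μ y / lik b x₀ y)) ∂unitExp

theorem outDiv_zero (b : ℝ) (μ : Measure ℝ≥0) :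
    outDiv b 0 μ = ∫⁻ y, ENNReal.ofReal (klFun (outDens b μ y)) ∂unitExp := by
  simp [outDiv, lik_zero]

theorem wardenDiv_eq_outDiv (μ : Measure ℝ≥0) [IsProbabilityMeasure μ] :
    wardenDiv μ = outDiv 1 0 μ := by
  have h := channel_comp_eq_withDensity 1 μ
  have f : IsFiniteMeasure (unitExp.withDensity
    fun y => ENNReal.ofReal (outDens (1 ^ 2) μ y)) := h ▸ inferInstance
  rw [wardenDiv, wardenChannel, h, channel_zero, klDiv_withDensity_left _ (by fun_prop),
    outDiv_zero, one_pow]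
  simp [ENNReal.toReal_ofReal (outDens_nonneg zero_le_one μ _)]

/-- After exchanging integrals, this is `lintegral_klFun_compensation` at each fixed output `y`. The
additive form in `ℝ≥0∞` needs no finiteness. -/
theorem mutualInfo_add_outDiv (θ : ℝ) (x₀ : ℝ≥0) (μ : Measure ℝ≥0) [IsProbabilityMeasure μ] :
    mutualInfo μ (channel θ) + outDiv (θ ^ 2) x₀ μ
      = ∫⁻ x, ENNReal.ofReal ((1 + θ ^ 2 * x) / (1 + θ ^ 2 * x₀) - 1
          + Real.log (1 + θ ^ 2 * x₀) - Real.log (1 + θ ^ 2 * x)) ∂μ := by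
  have hb := sq_nonneg θ
  have m1 : Measurable fun p : ℝ≥0 × ℝ => lik (θ ^ 2) p.1 p.2 := measurable_lik _
  simp_rw [← lintegral_klFun_lik hb x₀]
  rw [mutualInfo_eq_lintegral, lintegral_lintegral_swap (by fun_prop), outDiv,
    ← lintegral_add_right _ (by fun_prop)]
  conv_rhs => rw [lintegral_lintegral_swap (by fun_prop)]
  exact lintegral_congr fun y => lintegral_klFun_compensation μ (by fun_prop)
    (fun x => lik_pos hb x y) (fun x => lik_le_exp_abs hb x y) rfl (outDens_pos hb μ y)
    (lik_pos hb x₀ y)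

/-- The form used for existence: the terms added to the information are weakly lower semicontinuous,
and the mean, which is not continuous, carries a factor that tends to `0` as `x₀` grows. -/
theorem mutualInfo_add_outDiv_add_lintegral_log (θ : ℝ) (x₀ : ℝ≥0) (μ : Measure ℝ≥0)
    [IsProbabilityMeasure μ] :
    mutualInfo μ (channel θ) + outDiv (θ ^ 2) x₀ μ
        + ∫⁻ x : ℝ≥0, ENNReal.ofReal (Real.log (1 + θ ^ 2 * x)) ∂μ
      = ENNReal.ofReal (1 / (1 + θ ^ 2 * x₀) - 1 + Real.log (1 + θ ^ 2 * x₀))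
        + ENNReal.ofReal (θ ^ 2 / (1 + θ ^ 2 * x₀)) * ∫⁻ x : ℝ≥0, (x : ℝ≥0∞) ∂μ := by
  have hb := sq_nonneg θ
  have hx₀ := one_add_mul_pos hb x₀
  rw [mutualInfo_add_outDiv, ← lintegral_add_right _ (by fun_prop),
    ← lintegral_const_mul _ (by fun_prop)]
  have h1 : ∫⁻ _ : ℝ≥0, ENNReal.ofReal (1 / (1 + θ ^ 2 * x₀) - 1 + Real.log (1 + θ ^ 2 * x₀)) ∂μ
      = ENNReal.ofReal (1 / (1 + θ ^ 2 * x₀) - 1 + Real.log (1 + θ ^ 2 * x₀)) := by simp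
  rw [← h1, ← lintegral_add_left (by fun_prop)]
  refine lintegral_congr fun x => ?_
  have hx := one_add_mul_pos hb x
  have hl : 0 ≤ Real.log (1 + θ ^ 2 * x) := Real.log_nonneg (le_add_of_nonneg_right (by positivity))
  have key : ∀ t : ℝ, 0 < t → 0 ≤ t / (1 + θ ^ 2 * x₀) - 1
      + Real.log (1 + θ ^ 2 * x₀) - Real.log t := fun t ht => by
    have := Real.log_le_sub_one_of_pos (div_pos ht hx₀)
    rw [Real.log_div ht.ne' hx₀.ne'] at this
    linarith
  have h2 := key 1 one_pos
  rw [Real.log_one, sub_zero] at h2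
  rw [← ENNReal.ofReal_coe_nnreal (p := x), ← ENNReal.ofReal_mul (by positivity),
    ← ENNReal.ofReal_add (key _ hx) hl, ← ENNReal.ofReal_add h2 (by positivity)]
  congr 1
  ring

/-! ### Entropy duality and integrability. -/

/-- The Fenchel–Young inequality: `exp s - 1` is the convex conjugate of `klFun`. -/
theorem mul_le_klFun_add_exp_sub_one (s : ℝ) {t : ℝ} (ht : 0 ≤ t) :
    t * s ≤ klFun t + (Real.exp s - 1) := by
  rcases ht.eq_or_lt with rfl | ht
  · rw [klFun_zero, zero_mul]
    linarith [Real.exp_pos s]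
  · have h := Real.log_le_sub_one_of_pos (div_pos (Real.exp_pos s) ht)
    rw [Real.log_div (Real.exp_pos s).ne' ht.ne', Real.log_exp] at h
    have h' := mul_le_mul_of_nonneg_left h ht.le
    rw [mul_sub t (Real.exp s / t), mul_div_cancel₀ _ ht.ne'] at h'
    rw [klFun_apply]
    linarith

theorem lintegral_mul_outDens (hb : 0 ≤ b) (μ : Measure ℝ≥0) [IsFiniteMeasure μ] {f : ℝ → ℝ≥0∞}
    (hf : Measurable f) :
    ∫⁻ y, f y * ENNReal.ofReal (outDens b μ y) ∂unitExp
      = ∫⁻ x, ∫⁻ u, f ((1 + b * x) * u) ∂unitExp ∂μ := by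
  have m : Measurable fun p : ℝ≥0 × ℝ => f p.2 * ENNReal.ofReal (lik b p.1 p.2) :=
    (hf.comp measurable_snd).mul (measurable_lik b).ennreal_ofReal
  simp_rw [ofReal_outDens hb, ← lintegral_mul_lik hb _ hf]
  rw [lintegral_lintegral_swap (f := fun x y => f y * ENNReal.ofReal (lik b x y)) m.aemeasurable]
  refine lintegral_congr fun y => ?_
  rw [lintegral_const_mul _ (by fun_prop)]

/-- Fenchel–Young integrated over the output. The mean and tail bounds on feasible laws come from
this duality with a suitable test function `f`. -/
theorem lintegral_lintegral_le_outDiv_add (hb : 0 ≤ b) (μ : Measure ℝ≥0) [IsFiniteMeasure μ]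
    {f : ℝ → ℝ} (hf : Measurable f) :
    ∫⁻ x, ∫⁻ u, ENNReal.ofReal (f ((1 + b * x) * u)) ∂unitExp ∂μ
      ≤ outDiv b 0 μ + ∫⁻ y, ENNReal.ofReal (Real.exp (f y) - 1) ∂unitExp := by
  have m : Measurable fun y => klFun (outDens b μ y) :=
    measurable_klFun.comp (measurable_outDens b μ)
  rw [← lintegral_mul_outDens hb μ hf.ennreal_ofReal, outDiv_zero,
    ← lintegral_add_left m.ennreal_ofReal]
  refine lintegral_mono fun y => ?_
  have h := outDens_nonneg hb μ y
  rw [mul_comm, ← ENNReal.ofReal_mul h]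
  exact (ENNReal.ofReal_le_ofReal (mul_le_klFun_add_exp_sub_one (f y) h)).trans
    ENNReal.ofReal_add_le

/-- Duality with `f y = y / 2`: a slope below `1` keeps `exp (f y)` integrable against `unitExp`. -/
theorem lintegral_coe_le (μ : Measure ℝ≥0) [IsFiniteMeasure μ] :
    ∫⁻ x : ℝ≥0, (x : ℝ≥0∞) ∂μ ≤ 2 * (outDiv 1 0 μ + 1) := by
  have h := lintegral_lintegral_le_outDiv_add zero_le_one μ (f := fun y => 1 / 2 * y) (by fun_prop)
  have h1 : ∫⁻ y, ENNReal.ofReal (Real.exp (1 / 2 * y) - 1) ∂unitExp = 1 := by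
    have i := integrable_exp_mul_unitExp (c := 1 / 2) (by norm_num)
    have i' : Integrable (fun y => Real.exp (1 / 2 * y) - 1) unitExp := i.sub (integrable_const _)
    rw [← ofReal_integral_eq_lintegral_ofReal i', integral_sub i (integrable_const _), integral_exp_mul_unitExp (by norm_num)]
    · norm_num
    · filter_upwards [ae_nonneg_unitExp] with y hy
      simpa using hy
  rw [h1] at h
  refine le_trans ?_ (mul_le_mul_right h 2)
  rw [← lintegral_const_mul _ (by fun_prop)]
  refine lintegral_mono fun x => ?_
  have h2 : ∫⁻ u, ENNReal.ofReal (1 / 2 * ((1 + 1 * x) * u)) ∂unitExp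
      = ENNReal.ofReal (1 / 2 * (1 + 1 * x)) := by
    simp_rw [← mul_assoc]
    rw [← ofReal_integral_eq_lintegral_ofReal (integrable_id_unitExp.const_mul _),
      integral_const_mul, integral_id_unitExp, mul_one]
    filter_upwards [ae_nonneg_unitExp] with y hy
    simp only [Pi.zero_apply]
    positivity
  rw [h2, ← ENNReal.ofReal_ofNat 2, ← ENNReal.ofReal_mul (by norm_num),
    ← ENNReal.ofReal_coe_nnreal (p := x)]
  refine ENNReal.ofReal_le_ofReal ?_
  linarith

theorem integrable_coe_iff (μ : Measure ℝ≥0) :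
    Integrable (fun x : ℝ≥0 => (x : ℝ)) μ ↔ ∫⁻ x : ℝ≥0, (x : ℝ≥0∞) ∂μ < ∞ := by
  rw [Integrable, and_iff_right (by fun_prop), hasFiniteIntegral_iff_ofReal
    (Filter.Eventually.of_forall fun x => x.2)]
  simp

theorem integrable_coe_of_outDiv_lt_top (μ : Measure ℝ≥0) [IsFiniteMeasure μ]
    (h : outDiv 1 0 μ < ∞) : Integrable (fun x : ℝ≥0 => (x : ℝ)) μ := by
  rw [integrable_coe_iff]
  refine (lintegral_coe_le μ).trans_lt (ENNReal.mul_lt_top (by simp) ?_)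
  exact ENNReal.add_lt_top.2 ⟨h, by simp⟩

section Fubini

variable {μ : Measure ℝ≥0} [IsFiniteMeasure μ] {f : ℝ → ℝ} {A C : ℝ}

theorem integrable_comp_mul_unitExp (hf : Measurable f)
    (hfA : ∀ y, 0 ≤ y → |f y| ≤ A * y + C) {c : ℝ} (hc : 0 ≤ c) :
    Integrable (fun u => f (c * u)) unitExp := by
  refine Integrable.mono' (((integrable_id_unitExp.const_mul c).const_mul A).add
    (integrable_const C)) (hf.comp (measurable_const_mul c)).aestronglyMeasurable ?_
  filter_upwards [ae_nonneg_unitExp] with u hu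
  exact hfA _ (mul_nonneg hc hu)

theorem integral_abs_comp_mul_unitExp_le (hf : Measurable f)
    (hfA : ∀ y, 0 ≤ y → |f y| ≤ A * y + C) {c : ℝ} (hc : 0 ≤ c) :
    ∫ u, |f (c * u)| ∂unitExp ≤ A * c + C := by
  have i := ((integrable_id_unitExp.const_mul c).const_mul A).add (integrable_const C)
  have e : ∫ u, (A * (c * u) + C) ∂unitExp = A * c + C := by
    rw [integral_add ((integrable_id_unitExp.const_mul c).const_mul A) (integrable_const C),
      integral_const_mul, integral_const_mul, integral_id_unitExp]
    simp
  rw [← e]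
  refine integral_mono_ae (integrable_comp_mul_unitExp hf hfA hc).abs i ?_
  filter_upwards [ae_nonneg_unitExp] with u hu
  exact hfA _ (mul_nonneg hc hu)

theorem integrable_prod_mul_lik (hb : 0 ≤ b) (hμ : Integrable (fun x : ℝ≥0 => (x : ℝ)) μ)
    (hf : Measurable f) (hfA : ∀ y, 0 ≤ y → |f y| ≤ A * y + C) :
    Integrable (fun p : ℝ≥0 × ℝ => f p.2 * lik b p.1 p.2) (μ.prod unitExp) := by
  have m : Measurable fun p : ℝ≥0 × ℝ => lik b p.1 p.2 := measurable_lik b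
  have m' : Measurable fun p : ℝ≥0 × ℝ => f p.2 * lik b p.1 p.2 := by fun_prop
  rw [integrable_prod_iff m'.aestronglyMeasurable]
  refine ⟨Filter.Eventually.of_forall fun x => (integrable_mul_lik_iff hb x hf).2
    (integrable_comp_mul_unitExp hf hfA (one_add_mul_pos hb x).le), ?_⟩
  refine Integrable.mono' (g := fun x : ℝ≥0 => A * (1 + b * x) + C)
    ((((integrable_const _).add (hμ.const_mul b)).const_mul A).add (integrable_const C))
    m'.norm.stronglyMeasurable.integral_prod_right.aestronglyMeasurable
    (Filter.Eventually.of_forall fun x => ?_)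
  rw [Real.norm_of_nonneg (integral_nonneg fun _ => norm_nonneg _)]
  have e : ∀ y, ‖f y * lik b x y‖ = |f y| * lik b x y := fun y => by
    rw [norm_mul, Real.norm_of_nonneg (lik_pos hb x y).le, Real.norm_eq_abs]
  simp only [e]
  rw [integral_mul_lik hb x (f := fun y => |f y|) (by fun_prop)]
  exact integral_abs_comp_mul_unitExp_le hf hfA (one_add_mul_pos hb x).le

theorem integrable_mul_outDens (hb : 0 ≤ b) (hμ : Integrable (fun x : ℝ≥0 => (x : ℝ)) μ)
    (hf : Measurable f) (hfA : ∀ y, 0 ≤ y → |f y| ≤ A * y + C) :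
    Integrable (fun y => f y * outDens b μ y) unitExp := by
  have := (integrable_prod_mul_lik hb hμ hf hfA).integral_prod_right
  simpa only [integral_const_mul, outDens] using this

theorem integrable_integral_comp_mul (hb : 0 ≤ b) (hμ : Integrable (fun x : ℝ≥0 => (x : ℝ)) μ)
    (hf : Measurable f) (hfA : ∀ y, 0 ≤ y → |f y| ≤ A * y + C) :
    Integrable (fun x : ℝ≥0 => ∫ u, f ((1 + b * x) * u) ∂unitExp) μ := by
  have := (integrable_prod_mul_lik hb hμ hf hfA).integral_prod_left
  simpa only [integral_mul_lik hb _ hf] using this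

theorem integral_mul_outDens (hb : 0 ≤ b) (hμ : Integrable (fun x : ℝ≥0 => (x : ℝ)) μ)
    (hf : Measurable f) (hfA : ∀ y, 0 ≤ y → |f y| ≤ A * y + C) :
    ∫ y, f y * outDens b μ y ∂unitExp = ∫ x, ∫ u, f ((1 + b * x) * u) ∂unitExp ∂μ := by
  simp_rw [← integral_mul_lik hb _ hf, outDens, ← integral_const_mul]
  exact (integral_integral_swap (integrable_prod_mul_lik hb hμ hf hfA)).symm

end Fubini

/-! ### Real-valued divergence and information for laws of finite mean. -/

theorem outDens_le_exp_abs (hb : 0 ≤ b) (μ : Measure ℝ≥0) [IsProbabilityMeasure μ] (y : ℝ) :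
    outDens b μ y ≤ Real.exp |y| := by
  have := integral_mono (integrable_lik hb μ y) (integrable_const _)
    (fun x => lik_le_exp_abs hb x y)
  simpa [outDens] using this

theorem integrable_klFun_outDens (hb : 0 ≤ b) {μ : Measure ℝ≥0} [IsProbabilityMeasure μ]
    (hμ : Integrable (fun x : ℝ≥0 => (x : ℝ)) μ) :
    Integrable (fun y => klFun (outDens b μ y)) unitExp := by
  have i := integrable_mul_outDens hb hμ (f := fun y => |y|) (A := 1) (C := 0) (by fun_prop)
    (fun y hy => by simp [abs_of_nonneg hy])
  refine Integrable.mono' (i.add (integrable_const 1))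
    (measurable_klFun.comp (measurable_outDens b μ)).aestronglyMeasurable
    (Filter.Eventually.of_forall fun y => ?_)
  have h0 := outDens_pos hb μ y
  rw [Real.norm_of_nonneg (klFun_nonneg h0.le), klFun_apply]
  have h1 : Real.log (outDens b μ y) ≤ |y| := by
    rw [Real.log_le_iff_le_exp h0]
    exact outDens_le_exp_abs hb μ y
  have := mul_le_mul_of_nonneg_left h1 h0.le
  simp only [Pi.add_apply]
  linarith

/-- The real-valued relative entropy of the output law for the input law `μ` with respect to that
for the constant input `0`. -/
noncomputable def realDiv (b : ℝ) (μ : Measure ℝ≥0) : ℝ := ∫ y, klFun (outDens b μ y) ∂unitExp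

theorem realDiv_nonneg (hb : 0 ≤ b) (μ : Measure ℝ≥0) : 0 ≤ realDiv b μ :=
  integral_nonneg fun y => klFun_nonneg (outDens_nonneg hb μ y)

theorem outDiv_eq_ofReal (hb : 0 ≤ b) {μ : Measure ℝ≥0} [IsProbabilityMeasure μ]
    (hμ : Integrable (fun x : ℝ≥0 => (x : ℝ)) μ) :
    outDiv b 0 μ = ENNReal.ofReal (realDiv b μ) := by
  rw [outDiv_zero, realDiv, ofReal_integral_eq_lintegral_ofReal (integrable_klFun_outDens hb hμ)]
  exact Filter.Eventually.of_forall fun y => klFun_nonneg (outDens_nonneg hb μ y)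

/-- The relative entropy of the exponential law with mean `1 + t` with respect to that with
mean `1`. -/
noncomputable def expDiv (t : ℝ) : ℝ := t - Real.log (1 + t)

theorem expDiv_zero : expDiv 0 = 0 := by simp [expDiv]

theorem expDiv_nonneg {t : ℝ} (ht : 0 ≤ t) : 0 ≤ expDiv t := by
  have := Real.log_le_sub_one_of_pos (show 0 < 1 + t by linarith)
  unfold expDiv
  linarith

theorem expDiv_pos {t : ℝ} (ht : 0 < t) : 0 < expDiv t := by
  have := Real.log_lt_sub_one_of_pos (show 0 < 1 + t by linarith) (by linarith)
  unfold expDiv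
  linarith

theorem expDiv_le_self {t : ℝ} (ht : 0 ≤ t) : expDiv t ≤ t := by
  have := Real.log_nonneg (show 1 ≤ 1 + t by linarith)
  unfold expDiv
  linarith

theorem expDiv_le_sq {t : ℝ} (ht : 0 ≤ t) : expDiv t ≤ t ^ 2 / 2 := by
  have := Real.le_log_one_add_of_nonneg ht
  have h2 : t - t ^ 2 / 2 ≤ 2 * t / (t + 2) := by
    rw [le_div_iff₀ (by linarith)]
    nlinarith [pow_nonneg ht 3]
  unfold expDiv
  linarith

@[fun_prop]
theorem measurable_expDiv : Measurable expDiv := by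
  unfold expDiv
  fun_prop

theorem integrable_expDiv (hb : 0 ≤ b) {μ : Measure ℝ≥0}
    (hμ : Integrable (fun x : ℝ≥0 => (x : ℝ)) μ) :
    Integrable (fun x : ℝ≥0 => expDiv (b * x)) μ := by
  refine (hμ.const_mul b).mono' (measurable_expDiv.comp (by fun_prop)).aestronglyMeasurable
    (Filter.Eventually.of_forall fun x => ?_)
  have : 0 ≤ b * (x : ℝ) := by positivity
  rw [Real.norm_of_nonneg (expDiv_nonneg this)]
  exact expDiv_le_self this

/-- The compensation identity at `x₀ = 0`. The inequality is recorded because `ENNReal.ofReal` would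
hide a negative difference. -/
theorem mutualInfo_eq_ofReal (θ : ℝ) {μ : Measure ℝ≥0} [IsProbabilityMeasure μ]
    (hμ : Integrable (fun x : ℝ≥0 => (x : ℝ)) μ) :
    realDiv (θ ^ 2) μ ≤ ∫ x : ℝ≥0, expDiv (θ ^ 2 * x) ∂μ ∧ mutualInfo μ (channel θ)
      = ENNReal.ofReal (∫ x : ℝ≥0, expDiv (θ ^ 2 * x) ∂μ - realDiv (θ ^ 2) μ) := by
  have hb := sq_nonneg θ
  have h := mutualInfo_add_outDiv θ 0 μ
  have e : ∀ x : ℝ≥0, (1 + θ ^ 2 * x) / (1 + θ ^ 2 * ((0 : ℝ≥0) : ℝ)) - 1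
          + Real.log (1 + θ ^ 2 * ((0 : ℝ≥0) : ℝ)) - Real.log (1 + θ ^ 2 * x)
          = expDiv (θ ^ 2 * x) := fun x => by
    simp [expDiv]
  simp_rw [e] at h
  have hnn : ∀ x : ℝ≥0, 0 ≤ expDiv (θ ^ 2 * x) := fun x => expDiv_nonneg (by positivity)
  rw [← ofReal_integral_eq_lintegral_ofReal (integrable_expDiv hb hμ)
    (Filter.Eventually.of_forall hnn), outDiv_eq_ofReal hb hμ] at h
  have hle := (ENNReal.ofReal_le_ofReal_iff (integral_nonneg hnn)).1
    (le_of_le_of_eq le_add_self h)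
  refine ⟨hle, ?_⟩
  rw [ENNReal.ofReal_sub _ (realDiv_nonneg hb μ), ← h, ENNReal.add_sub_cancel_right (by simp)]

/-- The real-valued mutual information. -/
noncomputable def realInfo (b : ℝ) (μ : Measure ℝ≥0) : ℝ :=
  ∫ x : ℝ≥0, expDiv (b * x) ∂μ - realDiv b μ

theorem mutualInfo_eq_ofReal_realInfo (θ : ℝ) {μ : Measure ℝ≥0} [IsProbabilityMeasure μ]
    (hμ : Integrable (fun x : ℝ≥0 => (x : ℝ)) μ) :
    mutualInfo μ (channel θ) = ENNReal.ofReal (realInfo (θ ^ 2) μ) :=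
  (mutualInfo_eq_ofReal θ hμ).2

theorem realInfo_nonneg (θ : ℝ) {μ : Measure ℝ≥0} [IsProbabilityMeasure μ]
    (hμ : Integrable (fun x : ℝ≥0 => (x : ℝ)) μ) : 0 ≤ realInfo (θ ^ 2) μ :=
  sub_nonneg.2 (mutualInfo_eq_ofReal θ hμ).1

theorem mem_feasible_iff {ν : ℝ} (hν : 0 ≤ ν) (μ : Measure ℝ≥0) :
    μ ∈ feasible ν ↔ IsProbabilityMeasure μ ∧ Integrable (fun x : ℝ≥0 => (x : ℝ)) μ
      ∧ realDiv 1 μ ≤ ν := by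
  constructor
  · rintro ⟨⟨hp, h1⟩, h2⟩
    rw [wardenDiv_eq_outDiv] at h1 h2
    have hi := integrable_coe_of_outDiv_lt_top μ h1
    rw [outDiv_eq_ofReal zero_le_one hi, ENNReal.ofReal_le_ofReal_iff hν] at h2
    exact ⟨hp, hi, h2⟩
  · rintro ⟨hp, hi, h⟩
    have e : wardenDiv μ = ENNReal.ofReal (realDiv 1 μ) := by
      rw [wardenDiv_eq_outDiv, outDiv_eq_ofReal zero_le_one hi]
    exact ⟨⟨hp, e ▸ ENNReal.ofReal_lt_top⟩, e ▸ ENNReal.ofReal_le_ofReal h⟩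

/-! ### Pointwise inequalities for `klFun`. -/

/-- A convex function lies above its tangent at `t`, whose slope is `log t`. -/
theorem klFun_add_mul_log_le {s t : ℝ} (hs : 0 ≤ s) (ht : 0 < t) :
    klFun t + (s - t) * Real.log t ≤ klFun s := by
  have h := mul_le_klFun_add_exp_sub_one (Real.log t) hs
  rw [Real.exp_log ht] at h
  rw [klFun_apply t]
  linarith

theorem klFun_le_mul_log {t : ℝ} (ht : 0 < t) : klFun t ≤ (t - 1) * Real.log t := by
  have := Real.log_le_sub_one_of_pos ht
  rw [klFun_apply]
  linarith

theorem klFun_le_sq {t : ℝ} (ht : 0 ≤ t) : klFun t ≤ (t - 1) ^ 2 := by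
  rcases ht.eq_or_lt with rfl | ht
  · simp [klFun_zero]
  · have := mul_le_mul_of_nonneg_left (Real.log_le_sub_one_of_pos ht) ht.le
    rw [klFun_apply]
    linarith

/-- Comparison through the Hellinger term: `klFun t` dominates `(√t - 1) ^ 2`, and `√t + 1 ≤ 2`. -/
theorem sq_div_four_le_klFun {t : ℝ} (ht : 0 < t) (ht1 : t ≤ 1) : (t - 1) ^ 2 / 4 ≤ klFun t := by
  have hs : 0 < √t := Real.sqrt_pos.2 ht
  have hs1 : √t ≤ 1 := by simpa using Real.sqrt_le_sqrt ht1
  have h := Real.log_le_sub_one_of_pos (one_div_pos.2 hs)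
  rw [one_div, Real.log_inv, Real.log_sqrt ht.le] at h
  have hsq : t = √t ^ 2 := (Real.sq_sqrt ht.le).symm
  have h1 : t * (2 - 2 * (√t)⁻¹) ≤ t * Real.log t :=
    mul_le_mul_of_nonneg_left (by linarith) ht.le
  have h2 : t * (√t)⁻¹ = √t := by
    rw [← div_eq_mul_inv]
    exact Real.div_sqrt
  have h3 : (√t - 1) ^ 2 ≤ klFun t := by
    rw [klFun_apply]
    nlinarith
  refine le_trans ?_ h3
  have h4 : t - 1 = (√t - 1) * (√t + 1) := by nlinarith
  rw [h4, mul_pow]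
  have h5 : (√t + 1) ^ 2 ≤ 4 := by nlinarith
  nlinarith [sq_nonneg (√t - 1)]

theorem mul_log_one_add_le_klFun {v : ℝ} (hv : 0 ≤ v) :
    v * Real.log (1 + v) ≤ 2 * klFun (1 + v) := by
  have h := Real.le_log_one_add_of_nonneg hv
  rw [div_le_iff₀ (by linarith)] at h
  rw [klFun_apply]
  linarith

/-- The tangent at the dilated point reduces this to `v * log (1 + (1 + β) * v) ≤ 16 * klFun (1 +
v)`. The constant `16` comes from `v < 0`, where `v ≥ -1/4` keeps the argument of the logarithm at
least `1/2`, so that the left side is at most `4 * v ^ 2`. -/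
theorem klFun_scale_le {v β : ℝ} (hv : -(1 / 4) ≤ v) (hβ : 0 ≤ β) (hβ1 : β ≤ 1) :
    klFun (1 + (1 + β) * v) ≤ (1 + 16 * β) * klFun (1 + v) := by
  have hpos : 0 < 1 + (1 + β) * v := by nlinarith
  have h := klFun_add_mul_log_le (s := 1 + v) (t := 1 + (1 + β) * v) (by linarith) hpos
  have h1 : v * Real.log (1 + (1 + β) * v) ≤ 16 * klFun (1 + v) := by
    rcases le_or_gt 0 v with h0 | h0
    · have hl : Real.log (1 + (1 + β) * v) ≤ 2 * Real.log (1 + v) := by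
        rw [← Real.log_rpow (by linarith)]
        refine Real.log_le_log hpos ?_
        norm_num
        nlinarith
      have := mul_le_mul_of_nonneg_left hl h0
      have := mul_log_one_add_le_klFun h0
      have := klFun_nonneg (show 0 ≤ 1 + v by linarith)
      nlinarith
    · have hl := Real.one_sub_inv_le_log_of_pos hpos
      have h2 : 4 * v ≤ Real.log (1 + (1 + β) * v) := by
        refine le_trans ?_ hl
        rw [← one_div, one_sub_div hpos.ne', le_div_iff₀ hpos]
        have hw : -(1 / 2) ≤ (1 + β) * v := by nlinarith
        have := mul_nonneg (neg_nonneg.2 h0.le)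
          (show 0 ≤ 4 * (1 + (1 + β) * v) - (1 + β) by linarith)
        linarith
      have := mul_le_mul_of_nonpos_left h2 h0.le
      have := sq_div_four_le_klFun (t := 1 + v) (by linarith) (by linarith)
      nlinarith
  have h2 := mul_le_mul_of_nonneg_left h1 hβ
  nlinarith

/-! ### Thinned input laws and first-order comparison of divergences. -/

/-- The input law obtained from `μ` by scaling its part beyond `δ` by `s` and putting the remaining
mass at `0`. -/
noncomputable def thin (μ : Measure ℝ≥0) (δ : ℝ≥0) (s : ℝ) : Measure ℝ≥0 :=
  ENNReal.ofReal s • μ.restrict (Set.Ioi δ)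
    + ENNReal.ofReal (1 - s * μ.real (Set.Ioi δ)) • Measure.dirac 0

section Thin

variable {μ : Measure ℝ≥0} {δ : ℝ≥0} {s : ℝ}

theorem isProbabilityMeasure_thin [IsProbabilityMeasure μ] (hs : 0 ≤ s) (hs1 : s * μ.real (Set.Ioi δ) ≤ 1) :
    IsProbabilityMeasure (thin μ δ s) := by
  constructor
  have h : μ (Set.Ioi δ) = ENNReal.ofReal (μ.real (Set.Ioi δ)) := by simp
  simp only [thin, Measure.add_apply, Measure.smul_apply, Measure.restrict_apply_univ, smul_eq_mul,
    measure_univ, mul_one]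
  rw [h, ← ENNReal.ofReal_mul hs, ← ENNReal.ofReal_add (by positivity) (by linarith)]
  simp

theorem integrable_thin {f : ℝ≥0 → ℝ} (hf : IntegrableOn f (Set.Ioi δ) μ) :
    Integrable f (thin μ δ s) :=
  (hf.smul_measure ENNReal.ofReal_ne_top).add_measure
    ((integrable_dirac (by simp)).smul_measure ENNReal.ofReal_ne_top)

theorem integral_thin (hs : 0 ≤ s) (hs1 : s * μ.real (Set.Ioi δ) ≤ 1) {f : ℝ≥0 → ℝ}
    (hf : IntegrableOn f (Set.Ioi δ) μ) :
    ∫ x, f x ∂thin μ δ s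
      = s * ∫ x in Set.Ioi δ, f x ∂μ + (1 - s * μ.real (Set.Ioi δ)) * f 0 := by
  rw [thin, integral_add_measure (hf.smul_measure ENNReal.ofReal_ne_top)
    ((integrable_dirac (by simp)).smul_measure ENNReal.ofReal_ne_top), integral_smul_measure,
    integral_smul_measure, integral_dirac, ENNReal.toReal_ofReal hs,
    ENNReal.toReal_ofReal (by linarith), smul_eq_mul, smul_eq_mul]

/-- The excess over `1` of the output density of `thin μ δ 1`. -/
noncomputable def excess (b : ℝ) (μ : Measure ℝ≥0) (δ : ℝ≥0) (y : ℝ) : ℝ :=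
  outDens b (μ.restrict (Set.Ioi δ)) y - μ.real (Set.Ioi δ)

theorem outDens_thin [IsFiniteMeasure μ] (hb : 0 ≤ b) (hs : 0 ≤ s) (hs1 : s * μ.real (Set.Ioi δ) ≤ 1) (y : ℝ) :
    outDens b (thin μ δ s) y = 1 + s * excess b μ δ y := by
  rw [outDens, integral_thin hs hs1 (integrable_lik hb _ y), lik_zero, excess, outDens]
  ring

theorem neg_le_excess (hb : 0 ≤ b) (y : ℝ) : -μ.real (Set.Ioi δ) ≤ excess b μ δ y := by
  have := outDens_nonneg hb (μ.restrict (Set.Ioi δ)) y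
  unfold excess
  linarith

variable [IsProbabilityMeasure μ]

/-- The output density of the thinned law is `1 + s * excess` with `excess ≥ -1/4`, so
`klFun_scale_le` applies pointwise. This is the price of enlarging the far part. -/
theorem realDiv_thin_le (hb : 0 ≤ b) (hμ : Integrable (fun x : ℝ≥0 => (x : ℝ)) μ)
    (hδ : μ.real (Set.Ioi δ) ≤ 1 / 4) {β : ℝ} (hβ : 0 ≤ β) (hβ1 : β ≤ 1) :
    realDiv b (thin μ δ (1 + β)) ≤ (1 + 16 * β) * realDiv b (thin μ δ 1) := by
  have h0 : 0 ≤ μ.real (Set.Ioi δ) := measureReal_nonneg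
  have hs : (1 + β) * μ.real (Set.Ioi δ) ≤ 1 := by nlinarith
  have hs' : 1 * μ.real (Set.Ioi δ) ≤ 1 := by linarith
  have := isProbabilityMeasure_thin (by linarith) hs
  have := isProbabilityMeasure_thin zero_le_one hs'
  unfold realDiv
  rw [← integral_const_mul]
  refine integral_mono (integrable_klFun_outDens hb (integrable_thin hμ.integrableOn))
    ((integrable_klFun_outDens hb (integrable_thin hμ.integrableOn)).const_mul _) fun y => ?_
  simp only
  rw [outDens_thin hb (by linarith) hs, outDens_thin hb zero_le_one hs', one_mul]
  exact klFun_scale_le (by linarith [neg_le_excess (δ := δ) (μ := μ) hb y]) hβ hβ1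

/-- The log-likelihood of the output law of `thin μ δ 1`. -/
noncomputable def logLik (b : ℝ) (μ : Measure ℝ≥0) (δ : ℝ≥0) (y : ℝ) : ℝ :=
  Real.log (outDens b (thin μ δ 1) y)

theorem one_mul_measureReal_le : 1 * μ.real (Set.Ioi δ) ≤ 1 := by
  rw [one_mul]
  exact measureReal_le_one

instance : IsProbabilityMeasure (thin μ δ 1) :=
  isProbabilityMeasure_thin zero_le_one one_mul_measureReal_le

theorem outDens_thin_one (hb : 0 ≤ b) (y : ℝ) :
    outDens b (thin μ δ 1) y = 1 + excess b μ δ y := by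
  rw [outDens_thin hb zero_le_one one_mul_measureReal_le, one_mul]

@[fun_prop]
theorem measurable_logLik (b : ℝ) : Measurable (logLik b μ δ) := by
  unfold logLik
  fun_prop

theorem log_le_logLik (hb : 0 ≤ b) {η : ℝ} (hη : η < 1) (hδ : μ.real (Set.Ioi δ) ≤ η) (y : ℝ) :
    Real.log (1 - η) ≤ logLik b μ δ y := by
  refine Real.log_le_log (by linarith) ?_
  rw [outDens_thin_one hb]
  linarith [neg_le_excess (δ := δ) (μ := μ) hb y]

theorem logLik_le (hb : 0 ≤ b) {y : ℝ} (hy : 0 ≤ y) : logLik b μ δ y ≤ y := by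
  rw [logLik, Real.log_le_iff_le_exp (outDens_pos hb _ y)]
  simpa [abs_of_nonneg hy] using outDens_le_exp_abs hb (thin μ δ 1) y

theorem abs_logLik_le (hb : 0 ≤ b) (hδ : μ.real (Set.Ioi δ) < 1) {y : ℝ} (hy : 0 ≤ y) :
    |logLik b μ δ y| ≤ 1 * y + |Real.log (1 - μ.real (Set.Ioi δ))| := by
  have h1 := log_le_logLik hb hδ le_rfl y
  have h2 := logLik_le (μ := μ) (δ := δ) hb hy
  have h3 := neg_abs_le (Real.log (1 - μ.real (Set.Ioi δ)))
  have h4 := abs_nonneg (Real.log (1 - μ.real (Set.Ioi δ)))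
  rw [abs_le]
  constructor <;> linarith

/-- The integral of `logLik` against the difference of the output laws for the inputs `x` and
`0`. -/
noncomputable def logLikGap (b : ℝ) (μ : Measure ℝ≥0) (δ x : ℝ≥0) : ℝ :=
  ∫ u, (logLik b μ δ ((1 + b * x) * u) - logLik b μ δ u) ∂unitExp

theorem integrable_logLik_comp (hb : 0 ≤ b) (hδ : μ.real (Set.Ioi δ) < 1) (x : ℝ≥0) :
    Integrable (fun u => logLik b μ δ ((1 + b * x) * u)) unitExp :=
  integrable_comp_mul_unitExp (by fun_prop) (fun _ hy => abs_logLik_le hb hδ hy)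
    (one_add_mul_pos hb x).le

theorem integrable_logLik (hb : 0 ≤ b) (hδ : μ.real (Set.Ioi δ) < 1) :
    Integrable (logLik b μ δ) unitExp := by
  simpa using integrable_logLik_comp hb hδ 0

theorem logLikGap_eq (hb : 0 ≤ b) (hδ : μ.real (Set.Ioi δ) < 1) (x : ℝ≥0) :
    logLikGap b μ δ x = ∫ u, logLik b μ δ ((1 + b * x) * u) ∂unitExp
      - ∫ u, logLik b μ δ u ∂unitExp :=
  integral_sub (integrable_logLik_comp hb hδ x) (integrable_logLik hb hδ)

theorem integrable_logLikGap (hb : 0 ≤ b) (hμ : Integrable (fun x : ℝ≥0 => (x : ℝ)) μ)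
    (hδ : μ.real (Set.Ioi δ) < 1) (S : Set ℝ≥0) :
    IntegrableOn (logLikGap b μ δ) S μ := by
  have h : logLikGap b μ δ = fun x : ℝ≥0 => ∫ u, logLik b μ δ ((1 + b * x) * u) ∂unitExp
      - ∫ u, logLik b μ δ u ∂unitExp := funext fun x => logLikGap_eq hb hδ x
  rw [h]
  exact (integrable_integral_comp_mul hb hμ.integrableOn (by fun_prop)
    (fun _ hy => abs_logLik_le hb hδ hy)).sub (integrable_const _)

theorem integrable_mul_logLik (hb : 0 ≤ b) (hμ : Integrable (fun x : ℝ≥0 => (x : ℝ)) μ)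
    (hδ : μ.real (Set.Ioi δ) < 1) (S : Set ℝ≥0) :
    Integrable (fun y => (outDens b (μ.restrict S) y - μ.real S) * logLik b μ δ y) unitExp := by
  have i1 := integrable_mul_outDens (μ := μ.restrict S) hb hμ.integrableOn
    (measurable_logLik (μ := μ) (δ := δ) b) (fun _ hy => abs_logLik_le hb hδ hy)
  refine (i1.sub ((integrable_logLik hb hδ).const_mul (μ.real S))).congr
    (Filter.Eventually.of_forall fun y => ?_)
  simp only [Pi.sub_apply]
  ring

theorem integral_mul_logLik (hb : 0 ≤ b) (hμ : Integrable (fun x : ℝ≥0 => (x : ℝ)) μ)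
    (hδ : μ.real (Set.Ioi δ) < 1) (S : Set ℝ≥0) :
    ∫ y, (outDens b (μ.restrict S) y - μ.real S) * logLik b μ δ y ∂unitExp
      = ∫ x in S, logLikGap b μ δ x ∂μ := by
  have i1 := integrable_mul_outDens (μ := μ.restrict S) hb hμ.integrableOn
    (measurable_logLik (μ := μ) (δ := δ) b) (fun _ hy => abs_logLik_le hb hδ hy)
  have i2 := (integrable_logLik (μ := μ) (δ := δ) hb hδ).const_mul (μ.real S)
  have i3 := integrable_integral_comp_mul (μ := μ.restrict S) hb hμ.integrableOn
    (measurable_logLik (μ := μ) (δ := δ) b) (fun _ hy => abs_logLik_le hb hδ hy)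
  have e : ∀ y, (outDens b (μ.restrict S) y - μ.real S) * logLik b μ δ y
      = logLik b μ δ y * outDens b (μ.restrict S) y - μ.real S * logLik b μ δ y := fun y => by ring
  simp only [e, logLikGap_eq hb hδ]
  rw [integral_sub i1 i2, integral_sub i3 (integrable_const _), integral_const_mul,
    integral_mul_outDens (μ := μ.restrict S) hb hμ.integrableOn (by fun_prop)
    (fun _ hy => abs_logLik_le hb hδ hy)]
  simp

theorem outDens_eq_thin_add (hb : 0 ≤ b) (y : ℝ) :
    outDens b μ y = outDens b (thin μ δ 1) y
      + (outDens b (μ.restrict (Set.Iic δ)) y - μ.real (Set.Iic δ)) := by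
  have h1 := integral_add_compl (measurableSet_Iic (a := δ)) (integrable_lik hb μ y)
  have h2 := probReal_add_probReal_compl (μ := μ) (measurableSet_Iic (a := δ))
  rw [Set.compl_Iic] at h1 h2
  rw [outDens_thin_one hb, excess]
  unfold outDens
  linarith

/-- The tangent inequality at the thinned law: moving the mass of `[0, δ]` from `0` back to its
place changes the divergence to first order by the integral of `logLikGap`. -/
theorem realDiv_thin_add_le (hb : 0 ≤ b) (hμ : Integrable (fun x : ℝ≥0 => (x : ℝ)) μ)
    (hδ : μ.real (Set.Ioi δ) < 1) :
    realDiv b (thin μ δ 1) + ∫ x in Set.Iic δ, logLikGap b μ δ x ∂μ ≤ realDiv b μ := by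
  have i1 := integrable_klFun_outDens hb (integrable_thin (δ := δ) (s := 1) hμ.integrableOn)
  have i2 := integrable_mul_logLik hb hμ hδ (Set.Iic δ)
  rw [← integral_mul_logLik hb hμ hδ, realDiv, ← integral_add i1 i2]
  refine integral_mono (i1.add i2) (integrable_klFun_outDens hb hμ) fun y => ?_
  have h := klFun_add_mul_log_le (outDens_nonneg hb μ y) (outDens_pos hb (thin μ δ 1) y)
  have e := outDens_eq_thin_add (μ := μ) (δ := δ) hb y
  rw [show outDens b μ y - outDens b (thin μ δ 1) y
    = outDens b (μ.restrict (Set.Iic δ)) y - μ.real (Set.Iic δ) by linarith] at h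
  exact h

theorem realDiv_thin_le_integral (hb : 0 ≤ b) (hμ : Integrable (fun x : ℝ≥0 => (x : ℝ)) μ)
    (hδ : μ.real (Set.Ioi δ) < 1) :
    realDiv b (thin μ δ 1) ≤ ∫ x in Set.Ioi δ, logLikGap b μ δ x ∂μ := by
  rw [← integral_mul_logLik hb hμ hδ]
  refine integral_mono (integrable_klFun_outDens hb (integrable_thin hμ.integrableOn))
    (integrable_mul_logLik hb hμ hδ _) fun y => ?_
  have h := klFun_le_mul_log (outDens_pos hb (thin μ δ 1) y)
  rw [show outDens b (thin μ δ 1) y - 1 = outDens b (μ.restrict (Set.Ioi δ)) y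
    - μ.real (Set.Ioi δ) by rw [outDens_thin_one hb, excess]; ring] at h
  exact h

end Thin

/-! ### Lower and upper bounds on the log-likelihood gap. -/

section GapBounds

variable {μ : Measure ℝ≥0} {δ : ℝ≥0}

/-- The likelihood is convex in `y`, so on `[0, ∞)` its slope is at least the slope at `0`. -/
theorem lik_sub_ge (hb : 0 ≤ b) (x : ℝ≥0) {y z : ℝ} (hy : 0 ≤ y) (hyz : y ≤ z) :
    (z - y) * (b * x / (1 + b * x) ^ 2) ≤ lik b x z - lik b x y := by
  have hx := one_add_mul_pos hb x
  have hs := slope_nonneg hb x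
  set c := b * x / (1 + b * x) with hc
  have h1 : (z - y) * c ≤ Real.exp (z * c) - Real.exp (y * c) := by
    have h2 := Real.add_one_le_exp (z * c - y * c)
    have h3 : 1 ≤ Real.exp (y * c) := Real.one_le_exp (mul_nonneg hy hs)
    have h4 : Real.exp (z * c) = Real.exp (y * c) * Real.exp (z * c - y * c) := by
      rw [← Real.exp_add]; ring_nf
    have h5 : 0 ≤ z * c - y * c := by
      rw [← sub_mul]; exact mul_nonneg (sub_nonneg.2 hyz) hs
    nlinarith
  have h6 := mul_le_mul_of_nonneg_left h1 (one_div_pos.2 hx).le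
  calc (z - y) * (b * x / (1 + b * x) ^ 2) = 1 / (1 + b * x) * ((z - y) * c) := by
        rw [hc]; field_simp
    _ ≤ _ := h6
    _ = _ := by simp only [lik]; rw [← hc]; ring

/-- The integral over `(δ, ∞)` of the derivative at `0` of the likelihood. -/
noncomputable def tailSlope (b : ℝ) (μ : Measure ℝ≥0) (δ : ℝ≥0) : ℝ :=
  ∫ x : ℝ≥0 in Set.Ioi δ, b * x / (1 + b * x) ^ 2 ∂μ

theorem slope_div_le (hb : 0 ≤ b) (x : ℝ≥0) : b * x / (1 + b * x) ^ 2 ≤ 1 / 4 := by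
  have hx := one_add_mul_pos hb x
  rw [div_le_div_iff₀ (by positivity) (by norm_num)]
  nlinarith [sq_nonneg (1 - b * (x : ℝ))]

theorem slope_div_nonneg (hb : 0 ≤ b) (x : ℝ≥0) : 0 ≤ b * x / (1 + b * x) ^ 2 := by positivity

theorem integrableOn_slope_div [IsFiniteMeasure μ] (hb : 0 ≤ b) (S : Set ℝ≥0) :
    IntegrableOn (fun x : ℝ≥0 => b * x / (1 + b * x) ^ 2) S μ := by
  refine Integrable.of_bound (Measurable.aestronglyMeasurable (by fun_prop)) (1 / 4)
    (Filter.Eventually.of_forall fun x => ?_)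
  rw [Real.norm_of_nonneg (slope_div_nonneg hb x)]
  exact slope_div_le hb x

theorem tailSlope_nonneg (hb : 0 ≤ b) : 0 ≤ tailSlope b μ δ :=
  integral_nonneg fun x => slope_div_nonneg hb x

variable [IsProbabilityMeasure μ]

theorem tailSlope_le (hb : 0 ≤ b) : tailSlope b μ δ ≤ 1 / 4 := by
  refine (integral_mono (integrableOn_slope_div hb _) (integrable_const (1 / 4))
    (fun x => slope_div_le hb x)).trans ?_
  have : μ.real (Set.Ioi δ) ≤ 1 := measureReal_le_one
  simp only [integral_const, MeasurableSet.univ, measureReal_restrict_apply, Set.univ_inter,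
    smul_eq_mul]
  linarith

theorem outDens_thin_sub_ge (hb : 0 ≤ b) {y z : ℝ} (hy : 0 ≤ y) (hyz : y ≤ z) :
    (z - y) * tailSlope b μ δ ≤ outDens b (thin μ δ 1) z - outDens b (thin μ δ 1) y := by
  have i := fun y => integrable_lik hb (μ.restrict (Set.Ioi δ)) y
  rw [outDens_thin_one hb, outDens_thin_one hb, excess, excess, outDens, outDens, add_sub_add_left_eq_sub,
    sub_sub_sub_cancel_right, ← integral_sub (i z) (i y), tailSlope, ← integral_const_mul]
  exact integral_mono ((integrableOn_slope_div hb _).const_mul _) ((i z).sub (i y))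
    fun x => lik_sub_ge hb x hy hyz

theorem half_le_log_one_add {t : ℝ} (ht : 0 ≤ t) (ht1 : t ≤ 1) : t / 2 ≤ Real.log (1 + t) := by
  refine le_trans ?_ (Real.le_log_one_add_of_nonneg ht)
  rw [le_div_iff₀ (by linarith)]
  nlinarith

/-- The density grows by at least `b * x * u * tailSlope` from a value at most `exp u`. Since `b * x
≤ 4` and `tailSlope ≤ 1/4`, the relative growth obtained is at most `1`, where `log (1 + t) ≥ t /
2`. -/
theorem le_logLik_sub (hb : 0 ≤ b) {x : ℝ≥0} (hx : b * x ≤ 4) {u : ℝ} (hu : 0 ≤ u) :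
    b * x * tailSlope b μ δ / 2 * (u * Real.exp (-u))
      ≤ logLik b μ δ ((1 + b * x) * u) - logLik b μ δ u := by
  have hbx : 0 ≤ b * (x : ℝ) := by positivity
  have hT := tailSlope_nonneg (μ := μ) (δ := δ) hb
  have hT' := tailSlope_le (μ := μ) (δ := δ) hb
  have hG := outDens_pos hb (thin μ δ 1) u
  have hG' := outDens_pos hb (thin μ δ 1) ((1 + b * x) * u)
  have hGu : outDens b (thin μ δ 1) u ≤ Real.exp u := by
    simpa [abs_of_nonneg hu] using outDens_le_exp_abs hb (thin μ δ 1) u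
  have h1 := outDens_thin_sub_ge (μ := μ) (δ := δ) hb hu
    (show u ≤ (1 + b * x) * u by nlinarith [mul_nonneg hbx hu])
  have hue : u * Real.exp (-u) ≤ 1 := by
    have h2 := Real.add_one_le_exp u
    have h3 : Real.exp u * Real.exp (-u) = 1 := by rw [← Real.exp_add]; simp
    nlinarith [Real.exp_pos (-u)]
  have hue0 : 0 ≤ u * Real.exp (-u) := mul_nonneg hu (Real.exp_pos _).le
  set t := b * x * tailSlope b μ δ * (u * Real.exp (-u)) with ht
  have hbT : b * x * tailSlope b μ δ ≤ 1 := by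
    calc b * x * tailSlope b μ δ ≤ 4 * (1 / 4) := mul_le_mul hx hT' hT (by norm_num)
      _ = 1 := by norm_num
  have ht0 : 0 ≤ t := mul_nonneg (mul_nonneg hbx hT) hue0
  have ht1 : t ≤ 1 := mul_le_one₀ hbT hue0 hue
  have h4 : (1 + t) * outDens b (thin μ δ 1) u ≤ outDens b (thin μ δ 1) ((1 + b * x) * u) := by
    have h5 : t * outDens b (thin μ δ 1) u ≤ t * Real.exp u := mul_le_mul_of_nonneg_left hGu ht0
    have h6 : t * Real.exp u = b * x * tailSlope b μ δ * u := by
      rw [ht, mul_assoc, mul_assoc u, ← Real.exp_add]; simp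
    nlinarith
  have h7 := Real.log_le_log (by positivity) h4
  rw [Real.log_mul (by linarith) hG.ne'] at h7
  have h8 := half_le_log_one_add ht0 ht1
  unfold logLik
  calc b * x * tailSlope b μ δ / 2 * (u * Real.exp (-u)) = t / 2 := by rw [ht]; ring
    _ ≤ _ := by linarith

theorem integrable_mul_exp_neg_unitExp : Integrable (fun u => u * Real.exp (-u)) unitExp := by
  refine integrable_id_unitExp.mono (by fun_prop) ?_
  filter_upwards [ae_nonneg_unitExp] with u hu
  rw [norm_mul, Real.norm_of_nonneg (Real.exp_pos _).le]
  exact mul_le_of_le_one_right (norm_nonneg _) (Real.exp_le_one_iff.2 (by linarith))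

theorem le_logLikGap (hb : 0 ≤ b) (hδ : μ.real (Set.Ioi δ) < 1) {x : ℝ≥0} (hx : b * x ≤ 4) :
    b * x * tailSlope b μ δ / 8 ≤ logLikGap b μ δ x := by
  have h : ∫ u, b * x * tailSlope b μ δ / 2 * (u * Real.exp (-u)) ∂unitExp
      = b * x * tailSlope b μ δ / 8 := by
    rw [integral_const_mul, integral_mul_exp_neg_unitExp]
    ring
  rw [← h]
  refine integral_mono_ae (integrable_mul_exp_neg_unitExp.const_mul _)
    ((integrable_logLik_comp hb hδ x).sub (integrable_logLik hb hδ)) ?_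
  filter_upwards [ae_nonneg_unitExp] with u hu
  exact le_logLik_sub hb hx hu

/-- The saving from collapsing `[0, δ]` is linear in the small inputs. On the warden's channel it
pays for the competitor. -/
theorem realDiv_thin_add_mul_le (hb : 0 ≤ b) (hμ : Integrable (fun x : ℝ≥0 => (x : ℝ)) μ)
    (hδ : μ.real (Set.Ioi δ) < 1) (hbδ : b * δ ≤ 4) :
    realDiv b (thin μ δ 1) + b * (∫ x : ℝ≥0 in Set.Iic δ, (x : ℝ) ∂μ) * tailSlope b μ δ / 8
      ≤ realDiv b μ := by
  refine le_trans ?_ (realDiv_thin_add_le hb hμ hδ)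
  have e : b * (∫ x : ℝ≥0 in Set.Iic δ, (x : ℝ) ∂μ) * tailSlope b μ δ / 8
      = ∫ x : ℝ≥0 in Set.Iic δ, b * tailSlope b μ δ / 8 * (x : ℝ) ∂μ := by
    rw [integral_const_mul]; ring
  rw [e]
  gcongr ?_ + ?_
  · exact le_rfl
  refine setIntegral_mono_on (hμ.integrableOn.const_mul _) (integrable_logLikGap hb hμ hδ _)
    measurableSet_Iic fun x hx => ?_
  have hx' : (x : ℝ) ≤ δ := hx
  have := le_logLikGap (δ := δ) hb hδ ((mul_le_mul_of_nonneg_left hx' hb).trans hbδ)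
  linarith

/-- A bound on the gain in log-likelihood for inputs of size at most `3` when all but mass `η`
sits near `0`. -/
noncomputable def gapBound (b η : ℝ) : ℝ :=
  ∫ u, Real.log (1 + η * Real.exp ((1 + 3 * b) * u)) ∂unitExp - Real.log (1 - η)

theorem log_one_add_exp_le {η c u : ℝ} (hη : 0 ≤ η) (hη1 : η ≤ 1) (hc : 0 ≤ c) (hu : 0 ≤ u) :
    Real.log (1 + η * Real.exp (c * u)) ≤ 1 + c * u := by
  have h1 : 1 ≤ Real.exp (c * u) := Real.one_le_exp (mul_nonneg hc hu)
  have h2 : 1 + η * Real.exp (c * u) ≤ Real.exp 1 * Real.exp (c * u) := by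
    have := Real.add_one_le_exp 1
    nlinarith
  rw [Real.log_le_iff_le_exp (by positivity), Real.exp_add]
  exact h2

theorem log_one_add_exp_nonneg {η c u : ℝ} (hη : 0 ≤ η) :
    0 ≤ Real.log (1 + η * Real.exp (c * u)) :=
  Real.log_nonneg (le_add_of_nonneg_right (by positivity))

theorem integrable_log_one_add_exp {η c : ℝ} (hη : 0 ≤ η) (hη1 : η ≤ 1) (hc : 0 ≤ c) :
    Integrable (fun u => Real.log (1 + η * Real.exp (c * u))) unitExp := by
  refine ((integrable_const 1).add (integrable_id_unitExp.const_mul c)).mono'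
    (Measurable.aestronglyMeasurable (by fun_prop)) ?_
  filter_upwards [ae_nonneg_unitExp] with u hu
  rw [Real.norm_of_nonneg (log_one_add_exp_nonneg hη)]
  exact log_one_add_exp_le hη hη1 hc hu

theorem gapBound_nonneg {η : ℝ} (hη : 0 ≤ η) (hη1 : η < 1) : 0 ≤ gapBound b η := by
  have h1 : 0 ≤ ∫ u, Real.log (1 + η * Real.exp ((1 + 3 * b) * u)) ∂unitExp :=
    integral_nonneg fun u => log_one_add_exp_nonneg hη
  have h2 := Real.log_nonpos (show 0 ≤ 1 - η by linarith) (by linarith)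
  unfold gapBound
  linarith

theorem tendsto_gapBound (hb : 0 ≤ b) :
    Filter.Tendsto (gapBound b) (nhdsWithin 0 (Set.Ici 0)) (nhds 0) := by
  have h0 : (0 : ℝ) = (∫ _, (0 : ℝ) ∂unitExp) - Real.log (1 - 0) := by simp
  have hlt : ∀ᶠ η : ℝ in nhdsWithin 0 (Set.Ici 0), 0 ≤ η ∧ η ≤ 1 := by
    filter_upwards [self_mem_nhdsWithin, mem_nhdsWithin_of_mem_nhds (Iio_mem_nhds one_pos)]
      with η h1 h2 using ⟨h1, le_of_lt h2⟩
  unfold gapBound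
  conv => enter [3]; rw [h0]
  refine Filter.Tendsto.sub ?_ ?_
  · refine tendsto_integral_filter_of_dominated_convergence (fun u => 1 + (1 + 3 * b) * u)
      (Filter.Eventually.of_forall fun η => Measurable.aestronglyMeasurable (by fun_prop)) ?_
      ((integrable_const 1).add (integrable_id_unitExp.const_mul _)) ?_
    · filter_upwards [hlt] with η hη
      filter_upwards [ae_nonneg_unitExp] with u hu
      rw [Real.norm_of_nonneg (log_one_add_exp_nonneg hη.1)]
      exact log_one_add_exp_le hη.1 hη.2 (by positivity) hu
    · refine Filter.Eventually.of_forall fun u => ?_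
      have : ContinuousAt (fun η : ℝ => Real.log (1 + η * Real.exp ((1 + 3 * b) * u))) 0 := by
        refine ContinuousAt.log (by fun_prop) (by simp)
      have h := this.tendsto
      simp only [zero_mul, add_zero, Real.log_one] at h
      exact h.mono_left nhdsWithin_le_nhds
  · have : ContinuousAt (fun η : ℝ => Real.log (1 - η)) 0 :=
      ContinuousAt.log (by fun_prop) (by simp)
    exact this.tendsto.mono_left nhdsWithin_le_nhds

theorem logLik_le_log (hb : 0 ≤ b) {η y : ℝ} (hη : μ.real (Set.Ioi δ) ≤ η) (hy : 0 ≤ y) :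
    logLik b μ δ y ≤ Real.log (1 + η * Real.exp y) := by
  refine Real.log_le_log (outDens_pos hb _ y) ?_
  rw [outDens_thin_one hb, excess]
  have h0 : 0 ≤ μ.real (Set.Ioi δ) := measureReal_nonneg
  have h1 : outDens b (μ.restrict (Set.Ioi δ)) y ≤ μ.real (Set.Ioi δ) * Real.exp y := by
    have := integral_mono (integrable_lik hb (μ.restrict (Set.Ioi δ)) y) (integrable_const _)
      (fun x => lik_le_exp_abs hb x y)
    simpa [outDens, abs_of_nonneg hy] using this
  have h2 := mul_le_mul_of_nonneg_right hη (Real.exp_pos y).le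
  linarith

theorem logLikGap_le_gapBound (hb : 0 ≤ b) {η : ℝ} (hη : μ.real (Set.Ioi δ) ≤ η) (hη1 : η < 1)
    {x : ℝ≥0} (hx : x ≤ 3) : logLikGap b μ δ x ≤ gapBound b η := by
  have hη0 : 0 ≤ η := measureReal_nonneg.trans hη
  have hδ := hη.trans_lt hη1
  have i := integrable_log_one_add_exp hη0 hη1.le (show 0 ≤ 1 + 3 * b by positivity)
  have e : gapBound b η = ∫ u, (Real.log (1 + η * Real.exp ((1 + 3 * b) * u)) - Real.log (1 - η))
      ∂unitExp := by
    rw [integral_sub i (integrable_const _), gapBound]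
    simp
  rw [e]
  refine integral_mono_ae ((integrable_logLik_comp hb hδ x).sub (integrable_logLik hb hδ))
    (i.sub (integrable_const _)) ?_
  filter_upwards [ae_nonneg_unitExp] with u hu
  have hx' : (x : ℝ) ≤ 3 := by exact_mod_cast hx
  have h1 := logLik_le_log (δ := δ) hb hη (mul_nonneg (one_add_mul_pos hb x).le hu)
  have h2 := log_le_logLik hb hη1 hη u
  have h3 : (1 + b * x) * u ≤ (1 + 3 * b) * u := by
    refine mul_le_mul_of_nonneg_right ?_ hu
    nlinarith
  have h4 : Real.log (1 + η * Real.exp ((1 + b * x) * u))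
      ≤ Real.log (1 + η * Real.exp ((1 + 3 * b) * u)) := by
    refine Real.log_le_log (by positivity) ?_
    have := mul_le_mul_of_nonneg_left (Real.exp_le_exp.2 h3) hη0
    linarith
  linarith

theorem lik_add_le (hb : 0 ≤ b) (x : ℝ≥0) {y t : ℝ} (ht : 0 ≤ t) :
    lik b x (y + t) ≤ Real.exp t * lik b x y := by
  have hx := one_add_mul_pos hb x
  have h1 : t * (b * x / (1 + b * x)) ≤ t :=
    mul_le_of_le_one_right ht (slope_lt_one hb x).le
  have h2 := mul_le_mul_of_nonneg_right (Real.exp_le_exp.2 h1) (lik_pos hb x y).le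
  refine le_of_eq_of_le ?_ h2
  rw [lik, lik, add_mul, Real.exp_add]
  ring

/-- A shift of the output by `t ≥ 0` multiplies each likelihood by at most `exp t`; here the shift
is `b * x * u`, of mean `b * x`. -/
theorem logLikGap_le (hb : 0 ≤ b) (hδ : μ.real (Set.Ioi δ) < 1) (x : ℝ≥0) :
    logLikGap b μ δ x ≤ b * x := by
  have e : b * (x : ℝ) = ∫ u, b * x * u ∂unitExp := by
    rw [integral_const_mul, integral_id_unitExp, mul_one]
  rw [e]
  refine integral_mono_ae ((integrable_logLik_comp hb hδ x).sub (integrable_logLik hb hδ))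
    (integrable_id_unitExp.const_mul _) ?_
  filter_upwards [ae_nonneg_unitExp] with u hu
  have ht : 0 ≤ b * x * u := by positivity
  have h1 : outDens b (thin μ δ 1) ((1 + b * x) * u)
      ≤ Real.exp (b * x * u) * outDens b (thin μ δ 1) u := by
    unfold outDens
    rw [← integral_const_mul, show (1 + b * x) * u = u + b * x * u by ring]
    exact integral_mono (integrable_lik hb _ _) ((integrable_lik hb _ _).const_mul _)
      fun x' => lik_add_le hb x' ht
  have h2 := Real.log_le_log (outDens_pos hb _ _) h1
  rw [Real.log_mul (Real.exp_pos _).ne' (outDens_pos hb _ _).ne', Real.log_exp] at h2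
  simp only [logLik]
  linarith

/-- Inputs up to `3` contribute at most `gapBound`, which is small when the far mass is small;
inputs beyond `3` use the linear bound. This makes the divergence negligible against the first-order
information. -/
theorem realDiv_thin_le_gapBound (hb : 0 ≤ b) (hμ : Integrable (fun x : ℝ≥0 => (x : ℝ)) μ)
    {η : ℝ} (hη : μ.real (Set.Ioi δ) ≤ η) (hη1 : η < 1) (hδ3 : δ ≤ 3) :
    realDiv b (thin μ δ 1) ≤ gapBound b η * μ.real (Set.Ioi δ)
      + b * ∫ x : ℝ≥0 in Set.Ioi 3, (x : ℝ) ∂μ := by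
  have hδ := hη.trans_lt hη1
  have hg := gapBound_nonneg (b := b) (measureReal_nonneg.trans hη) hη1
  refine (realDiv_thin_le_integral hb hμ hδ).trans ?_
  have i2 : Integrable ((Set.Ioi (3 : ℝ≥0)).indicator fun x : ℝ≥0 => b * (x : ℝ)) μ :=
    (hμ.const_mul b).indicator measurableSet_Ioi
  have h : ∫ x : ℝ≥0 in Set.Ioi δ, (gapBound b η
      + (Set.Ioi (3 : ℝ≥0)).indicator (fun x : ℝ≥0 => b * (x : ℝ)) x) ∂μ
      = gapBound b η * μ.real (Set.Ioi δ) + b * ∫ x : ℝ≥0 in Set.Ioi 3, (x : ℝ) ∂μ := by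
    rw [integral_add (integrable_const _) i2.integrableOn, setIntegral_indicator measurableSet_Ioi,
      Set.inter_eq_right.2 (Set.Ioi_subset_Ioi hδ3), integral_const_mul]
    simp [mul_comm]
  rw [← h]
  refine integral_mono (integrable_logLikGap hb hμ hδ _)
    ((integrable_const _).add i2.integrableOn) fun x => ?_
  simp only
  by_cases hx : x ≤ 3
  · rw [Set.indicator_of_notMem (by simpa using hx), add_zero]
    exact logLikGap_le_gapBound hb hη hη1 hx
  · rw [Set.indicator_of_mem (by simpa using hx)]
    linarith [logLikGap_le (δ := δ) hb hδ x]

end GapBounds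

/-! ### Mean and tail of laws with small warden divergence. -/

theorem exp_neg_div_one_sub_le {s : ℝ} (hs : 0 ≤ s) (hs1 : s ≤ 1 / 2) :
    Real.exp (-s) * (1 / (1 - s)) ≤ 1 + 2 * s ^ 2 := by
  have h1 : Real.exp (-s) ≤ 1 / (1 + s) := by
    rw [Real.exp_neg, ← one_div]
    exact one_div_le_one_div_of_le (by linarith) (by linarith [Real.add_one_le_exp s])
  have h2 : 0 < 1 / (1 - s) := one_div_pos.2 (by linarith)
  refine (mul_le_mul_of_nonneg_right h1 h2.le).trans ?_
  rw [div_mul_div_comm, div_le_iff₀ (by nlinarith)]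
  nlinarith [sq_nonneg s, mul_nonneg hs (sub_nonneg.2 hs1)]

/-- Duality with `s * (y - 1)`: centring makes the exponential term at most `2 * s ^ 2`. Adding the
divergence and dividing by `s` gives `3 * s`. -/
theorem integral_coe_le {μ : Measure ℝ≥0} [IsProbabilityMeasure μ]
    (hμ : Integrable (fun x : ℝ≥0 => (x : ℝ)) μ) {s : ℝ} (hs : 0 < s) (hs1 : s ≤ 1 / 2)
    (h : realDiv 1 μ ≤ s ^ 2) : ∫ x : ℝ≥0, (x : ℝ) ∂μ ≤ 3 * s := by
  have hfA : ∀ y : ℝ, 0 ≤ y → |s * (y - 1)| ≤ s * y + s := fun y hy => by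
    rw [abs_le]; constructor <;> nlinarith
  have hm : Measurable fun y : ℝ => s * (y - 1) := by fun_prop
  have e1 : ∫ y, s * (y - 1) * outDens 1 μ y ∂unitExp = s * ∫ x : ℝ≥0, (x : ℝ) ∂μ := by
    rw [integral_mul_outDens (f := fun y => s * (y - 1)) zero_le_one hμ hm hfA,
      ← integral_const_mul]
    congr 1
    funext x
    rw [integral_const_mul, integral_sub (integrable_id_unitExp.const_mul _) (integrable_const _),
      integral_const_mul, integral_id_unitExp]
    simp
  have ie : Integrable (fun y => Real.exp (s * (y - 1))) unitExp := by
    refine ((integrable_exp_mul_unitExp (c := s) (by linarith)).const_mul (Real.exp (-s))).congr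
      (Filter.Eventually.of_forall fun y => ?_)
    simp only
    rw [← Real.exp_add]
    ring_nf
  have e2 : ∫ y, Real.exp (s * (y - 1)) ∂unitExp = Real.exp (-s) * (1 / (1 - s)) := by
    rw [← integral_exp_mul_unitExp (by linarith), ← integral_const_mul]
    congr 1
    funext y
    rw [← Real.exp_add]
    ring_nf
  have ie' : Integrable (fun y => Real.exp (s * (y - 1)) - 1) unitExp := ie.sub (integrable_const 1)
  have ik := integrable_klFun_outDens zero_le_one hμ
  have key : ∫ y, s * (y - 1) * outDens 1 μ y ∂unitExp
      ≤ ∫ y, (klFun (outDens 1 μ y) + (Real.exp (s * (y - 1)) - 1)) ∂unitExp := by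
    refine integral_mono (integrable_mul_outDens zero_le_one hμ hm hfA) (ik.add ie') fun y => ?_
    have := mul_le_klFun_add_exp_sub_one (s * (y - 1)) (outDens_nonneg zero_le_one μ y)
    simp only
    linarith
  rw [integral_add ik ie', integral_sub ie (integrable_const 1), e1, e2] at key
  have h3 := exp_neg_div_one_sub_le hs.le hs1
  have h4 : s * ∫ x : ℝ≥0, (x : ℝ) ∂μ ≤ s * (3 * s) := by
    simp only [integral_const, probReal_univ, smul_eq_mul, mul_one] at key
    unfold realDiv at h
    linarith
  exact le_of_mul_le_mul_left h4 hs

theorem le_lintegral_ofReal_mul_sub {k M : ℝ} (hk : 0 < k) (hM : 0 ≤ M) :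
    ENNReal.ofReal (k * Real.exp (-(M / k))) ≤ ∫⁻ u, ENNReal.ofReal (k * u - M) ∂unitExp := by
  have hMk : 0 ≤ M / k := div_nonneg hM hk.le
  rw [unitExp_eq_withDensity, lintegral_withDensity_eq_lintegral_mul _ (by fun_prop) (by fun_prop),
    -- Memorylessness: the shift by `M / k` starts the integral where the integrand becomes
    -- positive.
    ← lintegral_indicator measurableSet_Ici, ← lintegral_add_right_eq_self _ (M / k)]
  have h1 : ENNReal.ofReal (k * Real.exp (-(M / k)))
      = ∫⁻ u, ENNReal.ofReal (k * Real.exp (-(M / k)) * u) ∂unitExp := by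
    rw [← ofReal_integral_eq_lintegral_ofReal (integrable_id_unitExp.const_mul _),
      integral_const_mul, integral_id_unitExp, mul_one]
    filter_upwards [ae_nonneg_unitExp] with u hu
    simp only [Pi.zero_apply]
    positivity
  rw [h1, unitExp_eq_withDensity, lintegral_withDensity_eq_lintegral_mul _ (by fun_prop)
    (by fun_prop), ← lintegral_indicator measurableSet_Ici]
  refine lintegral_mono fun u => ?_
  by_cases hu : u ∈ Set.Ici (0 : ℝ)
  · have hu' : u + M / k ∈ Set.Ici (0 : ℝ) := add_nonneg hu hMk
    rw [Set.indicator_of_mem hu, Set.indicator_of_mem hu', Pi.mul_apply, Pi.mul_apply,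
      ← ENNReal.ofReal_mul (Real.exp_pos _).le, ← ENNReal.ofReal_mul (Real.exp_pos _).le,
      neg_add, Real.exp_add]
    refine le_of_eq ?_
    congr 1
    field_simp
    ring
  · rw [Set.indicator_of_notMem hu]
    exact zero_le

/-- Duality with `log (1 + t ^ 3 * exp (3 / 4 * y))`, whose exponential term is `4 * t ^ 3`. An
input `x > 3` contributes at least `3 / 4 * t * x`, hence the order `t ^ 2`, smaller than the `t ^
(3/2)` of the mean. -/
theorem setIntegral_Ioi_three_le {μ : Measure ℝ≥0} [IsProbabilityMeasure μ]
    (hμ : Integrable (fun x : ℝ≥0 => (x : ℝ)) μ) {t : ℝ} (ht : 0 < t) (ht1 : t ≤ 1)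
    (h : realDiv 1 μ ≤ t ^ 3) : ∫ x : ℝ≥0 in Set.Ioi 3, (x : ℝ) ∂μ ≤ 7 * t ^ 2 := by
  have hlog : Real.log t ≤ 0 := Real.log_nonpos ht.le ht1
  have hf : Measurable fun y : ℝ => Real.log (1 + t ^ 3 * Real.exp (3 / 4 * y)) := by fun_prop
  have h1 := lintegral_lintegral_le_outDiv_add zero_le_one μ hf
  have h2 : ∫⁻ y, ENNReal.ofReal (Real.exp (Real.log (1 + t ^ 3 * Real.exp (3 / 4 * y))) - 1)
      ∂unitExp = ENNReal.ofReal (4 * t ^ 3) := by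
    have e : ∀ y : ℝ, Real.exp (Real.log (1 + t ^ 3 * Real.exp (3 / 4 * y))) - 1
        = t ^ 3 * Real.exp (3 / 4 * y) := fun y => by
      rw [Real.exp_log (by positivity)]; ring
    simp only [e]
    rw [← ofReal_integral_eq_lintegral_ofReal
      ((integrable_exp_mul_unitExp (c := 3 / 4) (by norm_num)).const_mul _), integral_const_mul,
      integral_exp_mul_unitExp (by norm_num)]
    · congr 1
      ring
    · exact Filter.Eventually.of_forall fun y => by positivity
  rw [h2, outDiv_eq_ofReal zero_le_one hμ, ← ENNReal.ofReal_add (realDiv_nonneg zero_le_one μ)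
    (by positivity)] at h1
  have h3 : ∀ x : ℝ≥0, (Set.Ioi (3 : ℝ≥0)).indicator
      (fun x : ℝ≥0 => ENNReal.ofReal (3 / 4 * t * (x : ℝ))) x
      ≤ ∫⁻ u, ENNReal.ofReal (Real.log (1 + t ^ 3 * Real.exp (3 / 4 * ((1 + 1 * x) * u))))
        ∂unitExp := fun x => by
    by_cases hx : x ∈ Set.Ioi (3 : ℝ≥0)
    · have hx3 : (3 : ℝ) < x := by exact_mod_cast hx
      rw [Set.indicator_of_mem hx]
      have hk : 3 ≤ 3 / 4 * (1 + 1 * (x : ℝ)) := by linarith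
      refine le_trans ?_ ((le_lintegral_ofReal_mul_sub (k := 3 / 4 * (1 + 1 * (x : ℝ)))
        (M := -(3 * Real.log t)) (by linarith) (by linarith)).trans
        (lintegral_mono fun u => ENNReal.ofReal_le_ofReal ?_))
      · refine ENNReal.ofReal_le_ofReal ?_
        -- The right side is `t ^ (3 / k)` with `k = 3 / 4 * (1 + x)`; the threshold `x > 3` is what
        -- gives `k ≥ 3`.
        have h4 : t ≤ Real.exp (-(-(3 * Real.log t) / (3 / 4 * (1 + 1 * (x : ℝ))))) := by
          rw [← Real.log_le_iff_le_exp ht, neg_div, neg_neg, le_div_iff₀ (by linarith)]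
          nlinarith
        calc 3 / 4 * t * (x : ℝ) ≤ 3 / 4 * (1 + 1 * (x : ℝ)) * t := by nlinarith
          _ ≤ _ := mul_le_mul_of_nonneg_left h4 (by linarith)
      · have h5 : Real.log (t ^ 3 * Real.exp (3 / 4 * ((1 + 1 * x) * u)))
            = 3 / 4 * (1 + 1 * x) * u - -(3 * Real.log t) := by
          rw [Real.log_mul (by positivity) (Real.exp_pos _).ne', Real.log_exp, Real.log_pow]
          push_cast
          ring
        rw [← h5]
        exact Real.log_le_log (by positivity) (by linarith)
    · rw [Set.indicator_of_notMem hx]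
      exact zero_le
  have h6 := (lintegral_mono h3).trans h1
  rw [lintegral_indicator measurableSet_Ioi, ← ofReal_integral_eq_lintegral_ofReal
    (hμ.integrableOn.const_mul _) (Filter.Eventually.of_forall fun x => by positivity),
    ENNReal.ofReal_le_ofReal_iff (add_nonneg (realDiv_nonneg zero_le_one μ) (by positivity)),
    integral_const_mul] at h6
  have h7 : 3 / 4 * t * ∫ x : ℝ≥0 in Set.Ioi 3, (x : ℝ) ∂μ ≤ 3 / 4 * t * (7 * t ^ 2) := by
    have : 0 < t ^ 3 := by positivity
    nlinarith
  exact le_of_mul_le_mul_left h7 (by positivity)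

theorem measureReal_Ioi_le {μ : Measure ℝ≥0} [IsProbabilityMeasure μ]
    (hμ : Integrable (fun x : ℝ≥0 => (x : ℝ)) μ) {δ : ℝ≥0} (hδ : 0 < δ) :
    μ.real (Set.Ioi δ) ≤ (∫ x : ℝ≥0, (x : ℝ) ∂μ) / δ := by
  have hδ' : (0 : ℝ) < δ := hδ
  rw [le_div_iff₀ hδ', mul_comm]
  refine le_trans ?_ (mul_meas_ge_le_integral_of_nonneg
    (Filter.Eventually.of_forall fun x : ℝ≥0 => x.2) hμ δ)
  gcongr
  · exact measure_ne_top _ _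
  · intro x hx
    exact le_of_lt (NNReal.coe_lt_coe.2 hx)

/-! ### A two-point test law and the information at the optimum. -/

section TestLaw

variable {x₁ : ℝ≥0} {ε : ℝ}

theorem measureReal_dirac_Ioi (hx₁ : 0 < x₁) :
    (Measure.dirac x₁).real (Set.Ioi (0 : ℝ≥0)) = 1 := by
  simp [measureReal_def, hx₁]

theorem restrict_dirac_Ioi (hx₁ : 0 < x₁) :
    (Measure.dirac x₁).restrict (Set.Ioi (0 : ℝ≥0)) = Measure.dirac x₁ := by
  classical
  rw [restrict_dirac' measurableSet_Ioi, if_pos (show x₁ ∈ Set.Ioi (0 : ℝ≥0) from hx₁)]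

theorem integrable_coe_dirac (x₁ : ℝ≥0) :
    Integrable (fun x : ℝ≥0 => (x : ℝ)) (Measure.dirac x₁) := integrable_dirac (by simp)

theorem outDens_test (hb : 0 ≤ b) (hx₁ : 0 < x₁) (hε : 0 ≤ ε) (hε1 : ε ≤ 1) (y : ℝ) :
    outDens b (thin (Measure.dirac x₁) 0 ε) y = 1 + ε * (lik b x₁ y - 1) := by
  have h := measureReal_dirac_Ioi hx₁
  rw [outDens_thin hb hε (by rw [h]; linarith), excess, h, restrict_dirac_Ioi hx₁, outDens,
    integral_dirac]

/-- A chi-square bound: `b * x₁ ≤ 1/3` gives `lik ^ 2 ≤ exp (y / 2)`, of integral `2`, and the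
constant term adds `1`. -/
theorem realDiv_test_le (hb : 0 ≤ b) (hx₁ : 0 < x₁) (hbx : b * x₁ ≤ 1 / 3) (hε : 0 ≤ ε)
    (hε1 : ε ≤ 1) : realDiv b (thin (Measure.dirac x₁) 0 ε) ≤ 3 * ε ^ 2 := by
  have := isProbabilityMeasure_thin (μ := Measure.dirac x₁) (δ := 0) hε
    (by rw [measureReal_dirac_Ioi hx₁]; linarith)
  have ie := integrable_exp_mul_unitExp (c := 1 / 2) (by norm_num)
  have i1 : Integrable (fun y => ε ^ 2 * (Real.exp (1 / 2 * y) + 1)) unitExp :=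
    (ie.add (integrable_const 1)).const_mul _
  have e1 : ∫ y, ε ^ 2 * (Real.exp (1 / 2 * y) + 1) ∂unitExp = 3 * ε ^ 2 := by
    rw [integral_const_mul, integral_add ie (integrable_const _),
      integral_exp_mul_unitExp (by norm_num)]
    simp
    ring
  rw [← e1]
  refine integral_mono_ae (integrable_klFun_outDens hb (integrable_thin
    (integrable_coe_dirac x₁).integrableOn)) i1 ?_
  filter_upwards [ae_nonneg_unitExp] with y hy
  have h0 := outDens_nonneg hb (thin (Measure.dirac x₁) 0 ε) y
  refine (klFun_le_sq h0).trans ?_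
  rw [outDens_test hb hx₁ hε hε1, add_sub_cancel_left, mul_pow]
  refine mul_le_mul_of_nonneg_left ?_ (sq_nonneg _)
  have hl := lik_pos hb x₁ y
  have hx := one_add_mul_pos hb x₁
  have hbx0 : 0 ≤ b * (x₁ : ℝ) := by positivity
  have hl2 : lik b x₁ y ≤ Real.exp (1 / 4 * y) := by
    have h1 : 1 / (1 + b * (x₁ : ℝ)) ≤ 1 := by
      rw [div_le_one hx]; linarith
    have h2 : y * (b * x₁ / (1 + b * x₁)) ≤ 1 / 4 * y := by
      rw [mul_comm]
      refine mul_le_mul_of_nonneg_right ?_ hy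
      rw [div_le_iff₀ hx]
      linarith
    calc lik b x₁ y ≤ 1 * Real.exp (y * (b * x₁ / (1 + b * x₁))) :=
          mul_le_mul_of_nonneg_right h1 (Real.exp_pos _).le
      _ ≤ _ := by rw [one_mul]; exact Real.exp_le_exp.2 h2
  have hl3 : lik b x₁ y ^ 2 ≤ Real.exp (1 / 2 * y) := by
    calc lik b x₁ y ^ 2 ≤ Real.exp (1 / 4 * y) ^ 2 := pow_le_pow_left₀ hl.le hl2 2
      _ = _ := by rw [← Real.exp_nat_mul]; ring_nf
  nlinarith

theorem realInfo_thin {μ : Measure ℝ≥0} {δ : ℝ≥0} {s : ℝ} (hb : 0 ≤ b)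
    (hμ : Integrable (fun x : ℝ≥0 => (x : ℝ)) μ) (hs : 0 ≤ s)
    (hs1 : s * μ.real (Set.Ioi δ) ≤ 1) :
    realInfo b (thin μ δ s)
      = s * (∫ x : ℝ≥0 in Set.Ioi δ, expDiv (b * x) ∂μ) - realDiv b (thin μ δ s) := by
  rw [realInfo, integral_thin hs hs1 (integrable_expDiv hb hμ.integrableOn)]
  simp [expDiv_zero]

theorem le_realInfo_test (hb : 0 ≤ b) (hx₁ : 0 < x₁) (hbx : b * x₁ ≤ 1 / 3) (hε : 0 ≤ ε)
    (hε1 : ε ≤ 1) :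
    ε * expDiv (b * x₁) - 3 * ε ^ 2 ≤ realInfo b (thin (Measure.dirac x₁) 0 ε) := by
  rw [realInfo_thin hb (integrable_coe_dirac x₁) hε (by rw [measureReal_dirac_Ioi hx₁]; linarith),
    restrict_dirac_Ioi hx₁, integral_dirac]
  linarith [realDiv_test_le hb hx₁ hbx hε hε1]

end TestLaw

theorem realInfo_le_of_isOptimalInput {θ ν : ℝ} {μ μ' : Measure ℝ≥0} (hν : 0 ≤ ν)
    (h : IsOptimalInput θ ν μ) (h' : μ' ∈ feasible ν) :
    realInfo (θ ^ 2) μ' ≤ realInfo (θ ^ 2) μ := by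
  obtain ⟨hp, hi, -⟩ := (mem_feasible_iff hν μ).1 h.1
  obtain ⟨hp', hi', -⟩ := (mem_feasible_iff hν μ').1 h'
  have h1 : mutualInfo μ' (channel θ) ≤ mutualInfo μ (channel θ) := by
    rw [h.2]
    exact le_iSup₂ (f := fun μ (_ : μ ∈ feasible ν) => mutualInfo μ (channel θ)) μ' h'
  rw [mutualInfo_eq_ofReal_realInfo θ hi, mutualInfo_eq_ofReal_realInfo θ hi'] at h1
  exact (ENNReal.ofReal_le_ofReal_iff (realInfo_nonneg θ hi)).1 h1

theorem exists_le_realInfo_of_isOptimalInput {θ : ℝ} (hθ : 0 < θ) :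
    ∃ c : ℝ, 0 < c ∧ c ≤ θ ^ 2 / 12 ∧ ∀ (r : ℝ) (μ : Measure ℝ≥0), 0 < r → r ≤ 1 → r ^ 3 ≤ c →
      IsOptimalInput θ (r ^ 6) μ → c * r ^ 3 ≤ realInfo (θ ^ 2) μ := by
  have hb : 0 < θ ^ 2 := by positivity
  set b := θ ^ 2
  -- Small enough for the chi-square bound on both channels.
  let x₁ : ℝ≥0 := ⟨1 / (3 * (1 + b)), by positivity⟩
  have hx₁ : (x₁ : ℝ) = 1 / (3 * (1 + b)) := rfl
  have hx₁0 : (0 : ℝ) < x₁ := by rw [hx₁]; positivity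
  have h1 : 1 * (x₁ : ℝ) ≤ 1 / 3 := by
    rw [hx₁, one_mul, div_le_div_iff₀ (by positivity) (by norm_num)]
    linarith
  have hbx : b * (x₁ : ℝ) ≤ 1 / 3 := by
    rw [hx₁, mul_one_div, div_le_div_iff₀ (by positivity) (by norm_num)]
    linarith
  have hd := expDiv_pos (mul_pos hb hx₁0)
  have hd' := expDiv_le_self (mul_pos hb hx₁0).le
  refine ⟨expDiv (b * x₁) / 4, by linarith, by nlinarith, fun r μ hr hr1 hrc hμ => ?_⟩
  have hr3 : 0 < r ^ 3 := by positivity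
  have hr31 : r ^ 3 ≤ 1 := pow_le_one₀ hr.le hr1
  have hpos : 0 < x₁ := hx₁0
  have hε1 : r ^ 3 / 2 ≤ 1 := by linarith
  -- The weight `r ^ 3 / 2` keeps the warden's divergence at most `3 / 4 * r ^ 6`.
  have hT : thin (Measure.dirac x₁) 0 (r ^ 3 / 2) ∈ feasible (r ^ 6) := by
    rw [mem_feasible_iff (by positivity)]
    refine ⟨isProbabilityMeasure_thin (by positivity)
      (by rw [measureReal_dirac_Ioi hpos]; linarith),
      integrable_thin (integrable_coe_dirac x₁).integrableOn, ?_⟩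
    refine (realDiv_test_le zero_le_one hpos h1 (by positivity) hε1).trans ?_
    nlinarith [sq_nonneg (r ^ 3)]
  refine le_trans ?_ (realInfo_le_of_isOptimalInput (by positivity) hμ hT)
  refine le_trans ?_ (le_realInfo_test hb.le hpos hbx (by positivity) hε1)
  nlinarith

/-! ### The optimal law has an atom at `0`. -/

theorem setIntegral_expDiv_Iic_le (hb : 0 ≤ b) {μ : Measure ℝ≥0}
    (hμ : Integrable (fun x : ℝ≥0 => (x : ℝ)) μ) (δ : ℝ≥0) :
    ∫ x : ℝ≥0 in Set.Iic δ, expDiv (b * x) ∂μ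
      ≤ b ^ 2 * δ / 2 * ∫ x : ℝ≥0 in Set.Iic δ, (x : ℝ) ∂μ := by
  rw [← integral_const_mul]
  refine setIntegral_mono_on (integrable_expDiv hb hμ).integrableOn (hμ.integrableOn.const_mul _)
    measurableSet_Iic fun x hx => ?_
  have hx' : (x : ℝ) ≤ δ := hx
  refine (expDiv_le_sq (show 0 ≤ b * (x : ℝ) by positivity)).trans ?_
  have : (x : ℝ) * x ≤ δ * x := mul_le_mul_of_nonneg_right hx' x.2
  have := mul_le_mul_of_nonneg_left this (sq_nonneg b)
  nlinarith

theorem setIntegral_Ioi_eq_add {μ : Measure ℝ≥0} {f : ℝ≥0 → ℝ} (hf : Integrable f μ) {δ η : ℝ≥0}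
    (h : δ ≤ η) : ∫ x in Set.Ioi δ, f x ∂μ
      = ∫ x in Set.Ioc δ η, f x ∂μ + ∫ x in Set.Ioi η, f x ∂μ := by
  rw [← Set.Ioc_union_Ioi_eq_Ioi h, setIntegral_union (Set.Ioc_disjoint_Ioi le_rfl)
    measurableSet_Ioi hf.integrableOn hf.integrableOn]

theorem setIntegral_expDiv_Ioi_le (hb : 0 ≤ b) {μ : Measure ℝ≥0}
    (hμ : Integrable (fun x : ℝ≥0 => (x : ℝ)) μ) {δ : ℝ≥0} (hδ : δ ≤ 3) :
    ∫ x : ℝ≥0 in Set.Ioi δ, expDiv (b * x) ∂μ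
      ≤ b * (∫ x : ℝ≥0 in Set.Ioc δ 3, (x : ℝ) ∂μ) + b * ∫ x : ℝ≥0 in Set.Ioi 3, (x : ℝ) ∂μ := by
  rw [← mul_add, ← setIntegral_Ioi_eq_add hμ hδ, ← integral_const_mul]
  exact integral_mono (integrable_expDiv hb hμ).integrableOn (hμ.integrableOn.const_mul _)
    fun x => expDiv_le_self (by positivity)

/-- The slope `x / (1 + x) ^ 2` decays for large `x`, so only `x ≤ 3`, where the denominator is at
most `16`, is used. -/
theorem le_tailSlope_one {μ : Measure ℝ≥0} [IsProbabilityMeasure μ]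
    (hμ : Integrable (fun x : ℝ≥0 => (x : ℝ)) μ) (δ : ℝ≥0) :
    (∫ x : ℝ≥0 in Set.Ioc δ 3, (x : ℝ) ∂μ) / 16 ≤ tailSlope 1 μ δ := by
  have h1 : ∫ x : ℝ≥0 in Set.Ioc δ 3, 1 * (x : ℝ) / (1 + 1 * x) ^ 2 ∂μ ≤ tailSlope 1 μ δ :=
    setIntegral_mono_set (integrableOn_slope_div zero_le_one _)
      (Filter.Eventually.of_forall fun x => slope_div_nonneg zero_le_one x)
      Set.Ioc_subset_Ioi_self.eventuallyLE
  refine le_trans ?_ h1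
  rw [← integral_div]
  refine setIntegral_mono_on (hμ.integrableOn.div_const _) (integrableOn_slope_div zero_le_one _)
    measurableSet_Ioc fun x hx => ?_
  have hx3 : (x : ℝ) ≤ 3 := by exact_mod_cast hx.2
  have hx0 : (0 : ℝ) ≤ x := x.2
  rw [div_le_div_iff₀ (by norm_num) (by positivity), one_mul]
  refine mul_le_mul_of_nonneg_left ?_ hx0
  nlinarith

-- By contradiction: collapse `[0, δ]` to `0` and spend the warden's slack on enlarging the rest.
-- Cost and gain in information are both multiples of `m`, and `hδb` makes the gain larger.
set_option maxHeartbeats 1000000 in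
theorem zero_lt_measure_singleton_zero_of_isOptimalInput {θ : ℝ} (hθ : 0 < θ) {c r : ℝ}
    (hc : 0 < c) (hcb : c ≤ θ ^ 2 / 12) (hr : 0 < r) (hr1 : r ≤ 1 / 2) {δ : ℝ≥0} (hδ : 0 < δ)
    (hδ1 : δ ≤ 1) (hδb : (θ ^ 2) ^ 2 * δ < c * (c / (4096 * θ ^ 2)))
    (hη : 3 * r ^ 3 / δ ≤ 1 / 4) (hg : gapBound (θ ^ 2) (3 * r ^ 3 / δ) * (3 / δ) ≤ c / 128)
    (hbr : 7 * θ ^ 2 * r ≤ c / 128) {μ : Measure ℝ≥0} (hopt : IsOptimalInput θ (r ^ 6) μ)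
    (hI : c * r ^ 3 ≤ realInfo (θ ^ 2) μ) : 0 < μ {0} := by
  have hb : 0 < θ ^ 2 := by positivity
  set b := θ ^ 2 with hbdef
  have hr3 : 0 < r ^ 3 := by positivity
  have hr4 : 0 < r ^ 4 := by positivity
  have hδ' : (0 : ℝ) < δ := hδ
  have hδ1' : (δ : ℝ) ≤ 1 := hδ1
  have hδ3 : δ ≤ 3 := hδ1.trans (by norm_num)
  obtain ⟨hp, hi, hD⟩ := (mem_feasible_iff (by positivity) μ).1 hopt.1
  have hr2 : r ^ 3 ≤ 1 / 8 := by
    calc r ^ 3 ≤ (1 / 2) ^ 3 := pow_le_pow_left₀ hr.le hr1 3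
      _ = 1 / 8 := by norm_num
  have hmean := integral_coe_le hi hr3 (by linarith) (hD.trans_eq (by ring))
  have htail := setIntegral_Ioi_three_le hi (t := r ^ 2) (by positivity)
    (pow_le_one₀ hr.le (by linarith)) (hD.trans_eq (by ring))
  have hq : μ.real (Set.Ioi δ) ≤ 3 * r ^ 3 / δ :=
    (measureReal_Ioi_le hi hδ).trans (div_le_div_of_nonneg_right hmean hδ'.le)
  have hq0 : 0 ≤ μ.real (Set.Ioi δ) := measureReal_nonneg
  have hq1 : μ.real (Set.Ioi δ) < 1 := by linarith
  by_contra hzero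
  have hzero' : μ {0} = 0 := by simpa using hzero
  set m := ∫ x : ℝ≥0 in Set.Iic δ, (x : ℝ) ∂μ with hm
  have hm3 : m ≤ 3 * r ^ 3 := (setIntegral_le_integral hi
    (Filter.Eventually.of_forall fun x => x.2)).trans hmean
  -- Where the absence of an atom enters: `[0, δ]` has positive mass, and none of it sits at `0`.
  have hm0 : 0 < m := by
    rw [hm, setIntegral_pos_iff_support_of_nonneg_ae (Filter.Eventually.of_forall fun x => x.2)
      hi.integrableOn]
    have h1 : Function.support (fun x : ℝ≥0 => (x : ℝ)) ∩ Set.Iic δ = Set.Iic δ \ {0} := by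
      ext x; simp [and_comm]
    rw [h1, measure_sdiff_null hzero']
    have h2 := probReal_add_probReal_compl (μ := μ) (measurableSet_Iic (a := δ))
    rw [Set.compl_Iic] at h2
    have h3 : 0 < μ.real (Set.Iic δ) := by linarith
    exact (ENNReal.toReal_pos_iff.1 h3).1
  -- splitting the information of `μ` at `δ`
  set J := ∫ x : ℝ≥0 in Set.Ioi δ, expDiv (b * x) ∂μ with hJ
  set D := realDiv b (thin μ δ 1) with hDdef
  have hD0 : 0 ≤ D := realDiv_nonneg hb.le _
  have hE := setIntegral_expDiv_Iic_le hb.le hi δ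
  have hsplit : ∫ x : ℝ≥0, expDiv (b * x) ∂μ
      = ∫ x : ℝ≥0 in Set.Iic δ, expDiv (b * x) ∂μ + J := by
    rw [hJ, ← Set.compl_Iic, integral_add_compl measurableSet_Iic (integrable_expDiv hb.le hi)]
  -- `4096 = 16 * 32 * 8`: the `16` of `klFun_scale_le`, the `32` of `hslope` and the `8` of
  -- `realDiv_thin_add_mul_le`.
  set κ := c / (4096 * b) with hκ
  have hκ0 : 0 < κ := by positivity
  have hκ1 : κ ≤ 1 / 4096 := by
    rw [hκ, div_le_div_iff₀ (by positivity) (by norm_num)]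
    nlinarith
  have hbδ : b * δ ≤ 4 := by
    by_contra hcon
    have h1 : 4 * b < b ^ 2 * δ := by nlinarith
    have h2 : c * κ ≤ c * (1 / 4096) := mul_le_mul_of_nonneg_left hκ1 hc.le
    nlinarith
  have hDμ : D ≤ realDiv b μ := by
    have := realDiv_thin_add_mul_le hb.le hi hq1 hbδ
    have h0 : 0 ≤ b * m * tailSlope b μ δ / 8 := by
      have := tailSlope_nonneg (μ := μ) (δ := δ) hb.le
      positivity
    linarith
  have hA : realInfo b μ ≤ b ^ 2 * δ / 2 * m + J - D := by
    rw [realInfo, hsplit]; linarith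
  have hEr : b ^ 2 * δ / 2 * m ≤ c * r ^ 3 / 4 := by
    have h1 : b ^ 2 * δ / 2 ≤ c / 12 := by nlinarith
    calc b ^ 2 * δ / 2 * m ≤ c / 12 * (3 * r ^ 3) :=
          mul_le_mul h1 hm3 hm0.le (by positivity)
      _ = c * r ^ 3 / 4 := by ring
  have hJ1 : 3 / 4 * (c * r ^ 3) ≤ J := by linarith
  have htail' : b * ∫ x : ℝ≥0 in Set.Ioi 3, (x : ℝ) ∂μ ≤ c / 128 * r ^ 3 := by
    calc b * ∫ x : ℝ≥0 in Set.Ioi 3, (x : ℝ) ∂μ ≤ b * (7 * (r ^ 2) ^ 2) :=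
          mul_le_mul_of_nonneg_left htail hb.le
      _ = 7 * b * r * r ^ 3 := by ring
      _ ≤ _ := mul_le_mul_of_nonneg_right hbr hr3.le
  have hD1 : 16 * D ≤ c * r ^ 3 / 4 := by
    have h1 := realDiv_thin_le_gapBound hb.le hi hq (by linarith) hδ3
    have h2 : gapBound b (3 * r ^ 3 / δ) * μ.real (Set.Ioi δ) ≤ c / 128 * r ^ 3 := by
      calc gapBound b (3 * r ^ 3 / δ) * μ.real (Set.Ioi δ)
          ≤ gapBound b (3 * r ^ 3 / δ) * (3 * r ^ 3 / δ) := mul_le_mul_of_nonneg_left hq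
            (gapBound_nonneg (by positivity) (by linarith))
        _ = gapBound b (3 * r ^ 3 / δ) * (3 / δ) * r ^ 3 := by ring
        _ ≤ _ := mul_le_mul_of_nonneg_right hg hr3.le
    linarith
  -- the slack in the warden's constraint
  have hmid : c * r ^ 3 / (2 * b) ≤ ∫ x : ℝ≥0 in Set.Ioc δ 3, (x : ℝ) ∂μ := by
    have h1 := setIntegral_expDiv_Ioi_le hb.le hi hδ3
    rw [div_le_iff₀ (by positivity)]
    have : 0 < c * r ^ 3 := by positivity
    linarith
  have hslope : c * r ^ 3 / (32 * b) ≤ tailSlope 1 μ δ := by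
    refine le_trans ?_ (le_tailSlope_one hi δ)
    calc c * r ^ 3 / (32 * b) = c * r ^ 3 / (2 * b) / 16 := by field_simp; ring
      _ ≤ _ := by linarith
  have hgap := realDiv_thin_add_mul_le zero_le_one hi hq1 (by linarith)
  set D₁ := realDiv 1 (thin μ δ 1) with hD₁
  have hslack : D₁ + 16 * κ * (m * r ^ 3) ≤ r ^ 6 := by
    have h1 : 16 * κ * (m * r ^ 3) = 1 * m * (c * r ^ 3 / (32 * b)) / 8 := by
      rw [hκ]; field_simp; ring
    have h2 : 1 * m * (c * r ^ 3 / (32 * b)) ≤ 1 * m * tailSlope 1 μ δ :=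
      mul_le_mul_of_nonneg_left hslope (by linarith)
    linarith
  -- the competitor
  set β := κ * (m / r ^ 3) with hβ
  have hmr : m / r ^ 3 ≤ 3 := (div_le_iff₀ hr3).2 hm3
  have hmr0 : 0 < m / r ^ 3 := by positivity
  have hβ0 : 0 < β := mul_pos hκ0 hmr0
  have hβ1 : β ≤ 1 := by nlinarith
  have hβr : β * r ^ 3 = κ * m := by
    rw [hβ, mul_assoc, div_mul_cancel₀ _ hr3.ne']
  have hs : (1 + β) * μ.real (Set.Ioi δ) ≤ 1 := by nlinarith
  have hfeas : thin μ δ (1 + β) ∈ feasible (r ^ 6) := by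
    rw [mem_feasible_iff (by positivity)]
    refine ⟨isProbabilityMeasure_thin (by linarith) hs, integrable_thin hi.integrableOn, ?_⟩
    refine (realDiv_thin_le zero_le_one hi (by linarith) hβ0.le hβ1).trans ?_
    have hD₁0 : 0 ≤ D₁ := realDiv_nonneg zero_le_one _
    have hκm : 0 ≤ 16 * κ * (m * r ^ 3) := by positivity
    have h1 : 16 * β * D₁ ≤ 16 * β * r ^ 6 :=
      mul_le_mul_of_nonneg_left (by linarith) (by positivity)
    have h2 : 16 * β * r ^ 6 = 16 * κ * (m * r ^ 3) := by
      calc 16 * β * r ^ 6 = 16 * (β * r ^ 3) * r ^ 3 := by ring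
        _ = _ := by rw [hβr]; ring
    linarith
  have hle := realInfo_le_of_isOptimalInput (by positivity) hopt hfeas
  rw [← hbdef, realInfo_thin hb.le hi (by linarith) hs, ← hJ] at hle
  have hDβ := realDiv_thin_le hb.le hi (by linarith : μ.real (Set.Ioi δ) ≤ 1 / 4) hβ0.le hβ1
  rw [← hDdef] at hDβ
  have hgain : β * (c * r ^ 3 / 2) ≤ β * (J - 16 * D) :=
    mul_le_mul_of_nonneg_left (by linarith) hβ0.le
  have hgain' : β * (c * r ^ 3 / 2) = c * κ / 2 * m := by
    calc β * (c * r ^ 3 / 2) = c / 2 * (β * r ^ 3) := by ring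
      _ = _ := by rw [hβr]; ring
  have hlt : b ^ 2 * δ / 2 * m < c * κ / 2 * m := mul_lt_mul_of_pos_right (by linarith) hm0
  linarith

theorem exists_forall_zero_lt_measure_singleton_zero {θ : ℝ} (hθ : 0 < θ) :
    ∃ ν₀ : ℝ, 0 < ν₀ ∧ ∀ ν : ℝ, 0 < ν → ν < ν₀ → ∀ μ : Measure ℝ≥0,
      IsOptimalInput θ ν μ → 0 < μ {0} := by
  have hb : 0 < θ ^ 2 := by positivity
  obtain ⟨c, hc, hcb, hI⟩ := exists_le_realInfo_of_isOptimalInput hθ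
  have hK : 0 < c * (c / (4096 * θ ^ 2)) := by positivity
  set K := c * (c / (4096 * θ ^ 2)) with hKdef
  obtain ⟨δ, hδ0, hδ1, hδb⟩ : ∃ δ : ℝ≥0, 0 < δ ∧ δ ≤ 1 ∧ (θ ^ 2) ^ 2 * δ < K := by
    refine ⟨⟨min 1 (K / (2 * (θ ^ 2) ^ 2)), by positivity⟩, ?_, ?_, ?_⟩
    · exact NNReal.coe_pos.1 (lt_min one_pos (by positivity))
    · exact NNReal.coe_le_coe.1 (min_le_left _ _)
    · change (θ ^ 2) ^ 2 * min 1 (K / (2 * (θ ^ 2) ^ 2)) < K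
      calc (θ ^ 2) ^ 2 * min 1 (K / (2 * (θ ^ 2) ^ 2))
          ≤ (θ ^ 2) ^ 2 * (K / (2 * (θ ^ 2) ^ 2)) :=
            mul_le_mul_of_nonneg_left (min_le_right _ _) (by positivity)
        _ = K / 2 := by field_simp
        _ < K := by linarith
  have hδ' : (0 : ℝ) < δ := hδ0
  have hcont : ∀ f : ℝ → ℝ, Continuous f → f 0 = 0 → ∀ e, 0 < e →
      ∀ᶠ r in nhdsWithin (0 : ℝ) (Set.Ioi 0), f r < e := fun f hf hf0 e he => by
    have := hf.tendsto 0
    rw [hf0] at this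
    exact (this.mono_left nhdsWithin_le_nhds).eventually (gt_mem_nhds he)
  have hgt : Filter.Tendsto (fun r : ℝ => 3 * r ^ 3 / (δ : ℝ)) (nhdsWithin 0 (Set.Ioi 0))
      (nhdsWithin 0 (Set.Ici 0)) := by
    refine tendsto_nhdsWithin_iff.2 ⟨?_, ?_⟩
    · have : Continuous fun r : ℝ => 3 * r ^ 3 / (δ : ℝ) := by fun_prop
      have h := this.tendsto 0
      simp only [ne_eq, OfNat.ofNat_ne_zero, not_false_eq_true, zero_pow, mul_zero, zero_div] at h
      exact h.mono_left nhdsWithin_le_nhds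
    · filter_upwards [self_mem_nhdsWithin] with r hr
      have : (0 : ℝ) < r := hr
      exact Set.mem_Ici.2 (by positivity)
  have hg := (((tendsto_gapBound hb.le).comp hgt).mul_const (3 / (δ : ℝ))).eventually
    (gt_mem_nhds (show 0 * (3 / (δ : ℝ)) < c / 128 by rw [zero_mul]; positivity))
  have hev := hg.and ((hcont (fun r => r) (by fun_prop) rfl (1 / 2) (by norm_num)).and
    ((hcont (fun r => r ^ 3) (by fun_prop) (by norm_num) c hc).and
    ((hcont (fun r => 3 * r ^ 3 / δ) (by fun_prop) (by norm_num) (1 / 4) (by norm_num)).and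
    (hcont (fun r => 7 * θ ^ 2 * r) (by fun_prop) (by norm_num) (c / 128) (by positivity)))))
  obtain ⟨r₀, hr₀, hsub⟩ := mem_nhdsGT_iff_exists_Ioo_subset.1 hev
  refine ⟨r₀ ^ 6, by have : 0 < r₀ := hr₀; positivity, fun ν hν hν₀ μ hμ => ?_⟩
  -- The sixth root makes both `√ν = r ^ 3` (mean bound) and `ν ^ (1/3) = r ^ 2` (tail bound) powers
  -- of `r`.
  set r := ν ^ ((6 : ℕ) : ℝ)⁻¹ with hr
  have hr6 : r ^ 6 = ν := Real.rpow_inv_natCast_pow hν.le (by norm_num)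
  have hr0 : 0 < r := Real.rpow_pos_of_pos hν _
  have hrr : r < r₀ := lt_of_pow_lt_pow_left₀ 6 (le_of_lt hr₀) (by rw [hr6]; exact hν₀)
  obtain ⟨h1, h2, h3, h4, h5⟩ := hsub ⟨hr0, hrr⟩
  rw [← hr6] at hμ
  exact zero_lt_measure_singleton_zero_of_isOptimalInput hθ hc hcb hr0 h2.le hδ0 hδ1 hδb h4.le
    h1.le h5.le hμ (hI r μ hr0 (by linarith) h3.le hμ)

/-! ### Existence of an optimal law. -/

open Filter Topology

theorem liminf_add_liminf_le (u v : ℕ → ℝ≥0∞) :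
    liminf u atTop + liminf v atTop ≤ liminf (fun n => u n + v n) atTop := by
  have hmono : ∀ w : ℕ → ℝ≥0∞, Monotone fun n => ⨅ i, ⨅ _ : i ≥ n, w i := fun w n m hnm =>
    le_iInf₂ fun i hi => iInf₂_le i (hnm.trans hi)
  simp only [liminf_eq_iSup_iInf_of_nat]
  rw [ENNReal.iSup_add_iSup_of_monotone (hmono u) (hmono v)]
  exact iSup_mono fun n => le_iInf₂ fun i hi => add_le_add (iInf₂_le i hi) (iInf₂_le i hi)

theorem dirac_zero_mem_feasible {ν : ℝ} (hν : 0 ≤ ν) : Measure.dirac 0 ∈ feasible ν := by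
  rw [mem_feasible_iff hν]
  refine ⟨inferInstance, integrable_coe_dirac 0, ?_⟩
  have : ∀ y, outDens 1 (Measure.dirac 0) y = 1 := fun y => by
    rw [outDens, integral_dirac, lik_zero]
  simpa [realDiv, this, klFun_one] using hν

theorem lintegral_coe_le_of_mem_feasible {ν : ℝ} {μ : Measure ℝ≥0} (h : μ ∈ feasible ν) :
    ∫⁻ x : ℝ≥0, (x : ℝ≥0∞) ∂μ ≤ 2 * (ENNReal.ofReal ν + 1) := by
  have := h.1.1
  refine (lintegral_coe_le μ).trans ?_
  rw [← wardenDiv_eq_outDiv]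
  gcongr
  exact h.2

theorem isTightMeasureSet_feasible (ν : ℝ) : IsTightMeasureSet (feasible ν) := by
  rw [isTightMeasureSet_iff_exists_isCompact_measure_compl_le]
  intro ε hε
  set B : ℝ≥0∞ := 2 * (ENNReal.ofReal ν + 1) with hB
  have hBtop : B ≠ ∞ := by finiteness
  have hlim : Tendsto (fun n : ℕ => B / n) atTop (𝓝 0) := by
    simpa using ENNReal.Tendsto.const_div ENNReal.tendsto_nat_nhds_top (Or.inr hBtop)
  obtain ⟨n, hn1, hn⟩ := ((hlim.eventually (gt_mem_nhds hε)).and (eventually_gt_atTop 0)).exists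
  refine ⟨Set.Icc 0 (n : ℝ≥0), isCompact_Icc, fun μ hμ => ?_⟩
  refine le_trans ?_ hn1.le
  have h1 := meas_ge_le_lintegral_div (μ := μ) (f := fun x : ℝ≥0 => (x : ℝ≥0∞)) (by fun_prop)
    (ε := n) (by simpa using hn.ne') (by simp)
  refine (measure_mono fun x hx => ?_).trans (h1.trans
    (ENNReal.div_le_div_right (lintegral_coe_le_of_mem_feasible hμ) _))
  have : (n : ℝ≥0) < x := by simpa using hx
  have h2 : ((n : ℝ≥0) : ℝ≥0∞) ≤ x := ENNReal.coe_le_coe.2 this.le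
  simpa using h2

theorem exists_subseq_tendsto_of_mem_feasible {ν : ℝ} (u : ℕ → ProbabilityMeasure ℝ≥0)
    (hu : ∀ n, (u n : Measure ℝ≥0) ∈ feasible ν) :
    ∃ P : ProbabilityMeasure ℝ≥0, ∃ φ : ℕ → ℕ, StrictMono φ ∧ Tendsto (u ∘ φ) atTop (𝓝 P) := by
  have hc := isCompact_closure_of_isTightMeasureSet (S := Set.range u)
    ((isTightMeasureSet_feasible ν).subset (by rintro _ ⟨_, ⟨n, rfl⟩, rfl⟩; exact hu n))
  obtain ⟨P, -, φ, hφ, h⟩ := hc.tendsto_subseq fun n => subset_closure (Set.mem_range_self n)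
  exact ⟨P, φ, hφ, h⟩

theorem tendsto_outDens (hb : 0 ≤ b) {u : ℕ → ProbabilityMeasure ℝ≥0}
    {P : ProbabilityMeasure ℝ≥0} (h : Tendsto u atTop (𝓝 P)) (y : ℝ) :
    Tendsto (fun n => outDens b (u n) y) atTop (𝓝 (outDens b P y)) := by
  let f : BoundedContinuousFunction ℝ≥0 ℝ := BoundedContinuousFunction.ofNormedAddCommGroup
    (fun x => lik b x y) (continuous_lik_left hb y) (Real.exp |y|) fun x => by
      rw [Real.norm_of_nonneg (lik_pos hb x y).le]
      exact lik_le_exp_abs hb x y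
  exact ProbabilityMeasure.tendsto_iff_forall_integral_tendsto.1 h f

/-- Each likelihood is bounded and continuous in the input, so output densities converge pointwise
and Fatou's lemma applies. -/
theorem outDiv_le_liminf (hb : 0 ≤ b) (x₀ : ℝ≥0) {u : ℕ → ProbabilityMeasure ℝ≥0}
    {P : ProbabilityMeasure ℝ≥0} (h : Tendsto u atTop (𝓝 P)) :
    outDiv b x₀ P ≤ liminf (fun n => outDiv b x₀ (u n)) atTop := by
  unfold outDiv
  refine le_of_eq_of_le ?_ (lintegral_liminf_le fun n => ?_)
  · refine lintegral_congr fun y => ?_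
    have h1 := (tendsto_outDens hb h y).div_const (lik b x₀ y)
    have h2 := ((continuous_klFun.tendsto _).comp h1).const_mul (lik b x₀ y)
    exact ((ENNReal.continuous_ofReal.tendsto _).comp h2).liminf_eq.symm
  · have := measurable_klFun.comp ((measurable_outDens b (u n)).div (measurable_lik_right b x₀))
    exact ((measurable_lik_right b x₀).mul this).ennreal_ofReal

theorem lintegral_le_liminf_of_tendsto {f : ℝ≥0 → ℝ} (hf : Continuous f) (hf0 : 0 ≤ f)
    {u : ℕ → ProbabilityMeasure ℝ≥0} {P : ProbabilityMeasure ℝ≥0} (h : Tendsto u atTop (𝓝 P)) :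
    ∫⁻ x, ENNReal.ofReal (f x) ∂(P : Measure ℝ≥0)
      ≤ liminf (fun n => ∫⁻ x, ENNReal.ofReal (f x) ∂(u n : Measure ℝ≥0)) atTop :=
  lintegral_le_liminf_lintegral_of_forall_isOpen_measure_le_liminf_measure hf hf0
    fun _ hG => ProbabilityMeasure.le_liminf_measure_open_of_tendsto h hG

theorem mem_feasible_of_tendsto {ν : ℝ} {u : ℕ → ProbabilityMeasure ℝ≥0}
    {P : ProbabilityMeasure ℝ≥0} (h : Tendsto u atTop (𝓝 P))
    (hu : ∀ n, (u n : Measure ℝ≥0) ∈ feasible ν) : (P : Measure ℝ≥0) ∈ feasible ν := by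
  have h1 : wardenDiv P ≤ ENNReal.ofReal ν := by
    rw [wardenDiv_eq_outDiv]
    refine (outDiv_le_liminf zero_le_one 0 h).trans ?_
    refine liminf_le_of_le (by isBoundedDefault) fun c hc => ?_
    obtain ⟨n, hn⟩ := hc.exists
    refine hn.trans ?_
    rw [← wardenDiv_eq_outDiv]
    exact (hu n).2
  exact ⟨⟨inferInstance, h1.trans_lt ENNReal.ofReal_lt_top⟩, h1⟩

/-- Upper semicontinuity of the information up to an error: in the identity with reference `x₀` only
the mean can drop in the limit, and it is uniformly bounded on feasible laws. -/
theorem le_mutualInfo_add_of_tendsto {θ ν : ℝ} {u : ℕ → ProbabilityMeasure ℝ≥0}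
    {P : ProbabilityMeasure ℝ≥0} (h : Tendsto u atTop (𝓝 P))
    (hu : ∀ n, (u n : Measure ℝ≥0) ∈ feasible ν) {A : ℝ≥0∞}
    (hA : Tendsto (fun n => mutualInfo (u n : Measure ℝ≥0) (channel θ)) atTop (𝓝 A)) (x₀ : ℝ≥0) :
    A ≤ mutualInfo (P : Measure ℝ≥0) (channel θ)
      + ENNReal.ofReal (θ ^ 2 / (1 + θ ^ 2 * x₀)) * (2 * (ENNReal.ofReal ν + 1)) := by
  have hb := sq_nonneg θ
  have hP := mem_feasible_of_tendsto h hu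
  set B : ℝ≥0∞ := 2 * (ENNReal.ofReal ν + 1) with hB
  have hBtop : B ≠ ∞ := by finiteness
  set κ := ENNReal.ofReal (1 / (1 + θ ^ 2 * x₀) - 1 + Real.log (1 + θ ^ 2 * x₀)) with hκ
  set e := ENNReal.ofReal (θ ^ 2 / (1 + θ ^ 2 * x₀)) with he
  let L : Measure ℝ≥0 → ℝ≥0∞ := fun μ => ∫⁻ x : ℝ≥0, ENNReal.ofReal (Real.log (1 + θ ^ 2 * x)) ∂μ
  have hid : ∀ μ : Measure ℝ≥0, IsProbabilityMeasure μ →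
      mutualInfo μ (channel θ) + outDiv (θ ^ 2) x₀ μ + L μ
        = κ + e * ∫⁻ x : ℝ≥0, (x : ℝ≥0∞) ∂μ := fun μ _ =>
    mutualInfo_add_outDiv_add_lintegral_log θ x₀ μ
  have hL : L P ≤ liminf (fun n => L (u n)) atTop := by
    refine lintegral_le_liminf_of_tendsto ?_ (fun x => ?_) h
    · refine Continuous.log (by fun_prop) fun x => (one_add_mul_pos hb x).ne'
    · exact Real.log_nonneg (le_add_of_nonneg_right (by positivity))
  have h1 : A + outDiv (θ ^ 2) x₀ P + L P ≤ κ + e * B := by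
    calc A + outDiv (θ ^ 2) x₀ P + L P
        ≤ liminf (fun n => mutualInfo (u n : Measure ℝ≥0) (channel θ)) atTop
          + liminf (fun n => outDiv (θ ^ 2) x₀ (u n)) atTop + liminf (fun n => L (u n)) atTop := by
          rw [hA.liminf_eq]
          gcongr
          exact outDiv_le_liminf hb x₀ h
      _ ≤ liminf (fun n => mutualInfo (u n : Measure ℝ≥0) (channel θ)
          + outDiv (θ ^ 2) x₀ (u n)) atTop + liminf (fun n => L (u n)) atTop := by
          gcongr
          exact liminf_add_liminf_le _ _
      _ ≤ liminf (fun n => mutualInfo (u n : Measure ℝ≥0) (channel θ)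
          + outDiv (θ ^ 2) x₀ (u n) + L (u n)) atTop := liminf_add_liminf_le _ _
      _ ≤ κ + e * B := by
          refine liminf_le_of_le (by isBoundedDefault) fun c hc => ?_
          obtain ⟨n, hn⟩ := hc.exists
          refine hn.trans ?_
          rw [hid _ inferInstance]
          gcongr
          exact lintegral_coe_le_of_mem_feasible (hu n)
  have h2 := hid P inferInstance
  have hmean := (lintegral_coe_le_of_mem_feasible hP).trans_lt hBtop.lt_top
  have hfin : outDiv (θ ^ 2) x₀ P + L P ≠ ∞ := by
    have h3 : outDiv (θ ^ 2) x₀ P + L P ≤ κ + e * ∫⁻ x : ℝ≥0, (x : ℝ≥0∞) ∂(P : Measure ℝ≥0) := by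
      rw [← h2, add_assoc]
      exact le_add_self
    refine ne_top_of_le_ne_top ?_ h3
    exact ENNReal.add_ne_top.2 ⟨ENNReal.ofReal_ne_top,
      ENNReal.mul_ne_top ENNReal.ofReal_ne_top hmean.ne⟩
  -- The terms of the limit law can be cancelled because they are finite.
  rw [← ENNReal.add_le_add_iff_right hfin, ← add_assoc]
  refine h1.trans ?_
  calc κ + e * B ≤ (κ + e * ∫⁻ x : ℝ≥0, (x : ℝ≥0∞) ∂(P : Measure ℝ≥0)) + e * B := by
        gcongr
        exact le_self_add
    _ = _ := by rw [← h2]; ring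

theorem exists_isOptimalInput (θ : ℝ) {ν : ℝ} (hν : 0 ≤ ν) : ∃ μ, IsOptimalInput θ ν μ := by
  obtain ⟨a, -, ha, hmem⟩ := exists_seq_tendsto_sSup
    (S := (fun μ => mutualInfo μ (channel θ)) '' feasible ν)
    ⟨_, Set.mem_image_of_mem _ (dirac_zero_mem_feasible hν)⟩ (OrderTop.bddAbove _)
  choose μ hμ hμa using hmem
  let u : ℕ → ProbabilityMeasure ℝ≥0 := fun n => ⟨μ n, (hμ n).1.1⟩
  obtain ⟨P, φ, hφ, hP⟩ := exists_subseq_tendsto_of_mem_feasible u hμ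
  rw [sSup_image] at ha
  have hA : Tendsto (fun n => mutualInfo ((u ∘ φ) n : Measure ℝ≥0) (channel θ)) atTop
      (𝓝 (covertValue θ ν)) := by
    refine (ha.comp hφ.tendsto_atTop).congr fun n => ?_
    exact (hμa (φ n)).symm
  have hPf := mem_feasible_of_tendsto hP fun n => hμ (φ n)
  refine ⟨P, hPf, le_antisymm ?_ ?_⟩
  · exact le_iSup₂ (f := fun μ (_ : μ ∈ feasible ν) => mutualInfo μ (channel θ)) _ hPf
  have hB : 2 * (ENNReal.ofReal ν + 1) ≠ ∞ := by finiteness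
  -- Sending the reference input to infinity removes the error.
  have hlim : Tendsto (fun n : ℕ => mutualInfo (P : Measure ℝ≥0) (channel θ)
      + ENNReal.ofReal (θ ^ 2 / (1 + θ ^ 2 * ((n : ℝ≥0) : ℝ))) * (2 * (ENNReal.ofReal ν + 1)))
      atTop (𝓝 (mutualInfo (P : Measure ℝ≥0) (channel θ) + 0 * (2 * (ENNReal.ofReal ν + 1)))) := by
    refine Tendsto.const_add _ (ENNReal.Tendsto.mul_const ?_ (Or.inr hB))
    rw [← ENNReal.ofReal_zero]
    refine ENNReal.tendsto_ofReal ?_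
    rcases (sq_nonneg θ).eq_or_lt with h0 | h0
    · simp [← h0]
    · refine Tendsto.const_div_atTop ?_ _
      simp only [NNReal.coe_natCast]
      exact tendsto_atTop_add_const_left _ _ (tendsto_natCast_atTop_atTop.const_mul_atTop h0)
  rw [zero_mul, add_zero] at hlim
  exact ge_of_tendsto' hlim fun n => le_mutualInfo_add_of_tendsto hP (fun n => hμ (φ n)) hA n

/-! ### The output density determines the input law; uniqueness. -/

theorem integral_pow_exp_slope (hb : 0 ≤ b) (μ : Measure ℝ≥0) (n : ℕ) :
    ∫ x : ℝ≥0, Real.exp (b * x / (1 + b * x)) ^ n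
      ∂(μ.withDensity fun x => ENNReal.ofReal (1 / (1 + b * x))) = outDens b μ n := by
  rw [integral_withDensity_eq_integral_toReal_smul (by fun_prop)
    (Eventually.of_forall fun _ => ENNReal.ofReal_lt_top), outDens]
  congr 1
  funext x
  rw [ENNReal.toReal_ofReal (one_div_pos.2 (one_add_mul_pos hb x)).le, smul_eq_mul, lik,
    ← Real.exp_nat_mul]

/-- Polynomials in one injective bounded continuous function form an algebra that separates points,
hence determine a finite measure. -/
theorem eq_of_forall_integral_pow_eq {ρ₁ ρ₂ : Measure ℝ≥0} [IsFiniteMeasure ρ₁]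
    [IsFiniteMeasure ρ₂] (g : BoundedContinuousFunction ℝ≥0 ℝ) (hg : Function.Injective g)
    (h : ∀ n : ℕ, ∫ x, g x ^ n ∂ρ₁ = ∫ x, g x ^ n ∂ρ₂) : ρ₁ = ρ₂ := by
  let A : StarSubalgebra ℝ (BoundedContinuousFunction ℝ≥0 ℝ) :=
    { Algebra.adjoin ℝ {g} with
      star_mem' := fun {f} hf => by
        have : star f = f := by ext x; simp
        rwa [this] }
  refine ext_of_forall_mem_subalgebra_integral_eq_of_polish (𝕜 := ℝ) (A := A) ?_ ?_
  · intro x y hxy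
    refine ⟨g, ⟨g.toContinuousMapStarₐ ℝ, ⟨g, Algebra.subset_adjoin rfl, rfl⟩, rfl⟩, ?_⟩
    exact fun he => hxy (hg he)
  · intro f hf
    have hf' : f ∈ Algebra.adjoin ℝ {g} := hf
    rw [Algebra.adjoin_singleton_eq_range_aeval] at hf'
    obtain ⟨p, rfl⟩ := hf'
    have hi : ∀ (ρ : Measure ℝ≥0) [IsFiniteMeasure ρ] (n : ℕ), Integrable (fun x => g x ^ n) ρ :=
      fun ρ _ n => (g ^ n).integrable ρ
    have key : ∀ (ρ : Measure ℝ≥0) [IsFiniteMeasure ρ],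
        ∫ x, (Polynomial.aeval g p : BoundedContinuousFunction ℝ≥0 ℝ) x ∂ρ
          = ∑ n ∈ Finset.range (p.natDegree + 1), p.coeff n * ∫ x, g x ^ n ∂ρ := fun ρ _ => by
      simp_rw [← integral_const_mul]
      rw [← integral_finsetSum _ fun n _ => (hi ρ n).const_mul _]
      congr 1
      funext x
      rw [Polynomial.aeval_eq_sum_range]
      simp [BoundedContinuousFunction.sum_apply]
    change ∫ x, (Polynomial.aeval g p : BoundedContinuousFunction ℝ≥0 ℝ) x ∂ρ₁
      = ∫ x, (Polynomial.aeval g p : BoundedContinuousFunction ℝ≥0 ℝ) x ∂ρ₂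
    rw [key ρ₁, key ρ₂]
    simp_rw [h]

/-- The values at integers are the moments of the injective function `exp (b * x / (1 + b * x))`
under the law reweighted by `1 / (1 + b * x)`, and the positive weight can be divided out. -/
theorem eq_of_outDens_eq (hb : 0 < b) {μ₁ μ₂ : Measure ℝ≥0} [IsFiniteMeasure μ₁]
    [IsFiniteMeasure μ₂] (h : ∀ n : ℕ, outDens b μ₁ n = outDens b μ₂ n) : μ₁ = μ₂ := by
  have hm : Measurable fun x : ℝ≥0 => ENNReal.ofReal (1 / (1 + b * x)) := by fun_prop
  have hle : ∀ x : ℝ≥0, 1 / (1 + b * (x : ℝ)) ≤ 1 := fun x => by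
    rw [div_le_one (one_add_mul_pos hb.le x)]
    have : 0 ≤ b * (x : ℝ) := by positivity
    linarith
  have hfin : ∀ (μ : Measure ℝ≥0) [IsFiniteMeasure μ],
      IsFiniteMeasure (μ.withDensity fun x => ENNReal.ofReal (1 / (1 + b * x))) := fun μ _ => by
    refine isFiniteMeasure_withDensity_ofReal (Integrable.hasFiniteIntegral ?_)
    refine Integrable.of_bound (Measurable.aestronglyMeasurable (by fun_prop)) 1
      (Eventually.of_forall fun x => ?_)
    rw [Real.norm_of_nonneg (one_div_pos.2 (one_add_mul_pos hb.le x)).le]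
    exact hle x
  have := hfin μ₁
  have := hfin μ₂
  have hcont : Continuous fun x : ℝ≥0 => Real.exp (b * x / (1 + b * x)) := by
    have : ∀ x : ℝ≥0, 1 + b * (x : ℝ) ≠ 0 := fun x => (one_add_mul_pos hb.le x).ne'
    fun_prop (disch := exact this _)
  let g : BoundedContinuousFunction ℝ≥0 ℝ := BoundedContinuousFunction.ofNormedAddCommGroup
    (fun x : ℝ≥0 => Real.exp (b * x / (1 + b * x))) hcont (Real.exp 1) fun x => by
      rw [Real.norm_of_nonneg (Real.exp_pos _).le]
      exact Real.exp_le_exp.2 (slope_lt_one hb.le x).le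
  have hg : Function.Injective g := fun x y hxy => by
    have h1 : b * (x : ℝ) / (1 + b * x) = b * y / (1 + b * y) := Real.exp_injective hxy
    rw [div_eq_div_iff (one_add_mul_pos hb.le x).ne' (one_add_mul_pos hb.le y).ne'] at h1
    have h2 : b * ((x : ℝ) - y) = 0 := by linarith
    exact NNReal.coe_injective (sub_eq_zero.1 ((mul_eq_zero.1 h2).resolve_left hb.ne'))
  have heq := eq_of_forall_integral_pow_eq
    (ρ₁ := μ₁.withDensity fun x => ENNReal.ofReal (1 / (1 + b * x)))
    (ρ₂ := μ₂.withDensity fun x => ENNReal.ofReal (1 / (1 + b * x))) g hg fun n =>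
      (integral_pow_exp_slope hb.le μ₁ n).trans
        ((h n).trans (integral_pow_exp_slope hb.le μ₂ n).symm)
  have hne : ∀ (μ : Measure ℝ≥0), ∀ᵐ x : ℝ≥0 ∂μ, ENNReal.ofReal (1 / (1 + b * x)) ≠ 0 := fun μ =>
    Eventually.of_forall fun x => by
      rw [Ne, ENNReal.ofReal_eq_zero, not_le]
      exact one_div_pos.2 (one_add_mul_pos hb.le x)
  have htop : ∀ (μ : Measure ℝ≥0), ∀ᵐ x : ℝ≥0 ∂μ, ENNReal.ofReal (1 / (1 + b * x)) ≠ ∞ := fun μ =>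
    Eventually.of_forall fun x => ENNReal.ofReal_ne_top
  rw [← withDensity_inv_same hm (hne μ₁) (htop μ₁), heq,
    withDensity_inv_same hm (hne μ₂) (htop μ₂)]

theorem eq_of_ae_outDens_eq (hb : 0 < b) {μ₁ μ₂ : Measure ℝ≥0} [IsFiniteMeasure μ₁]
    [IsFiniteMeasure μ₂] (h : ∀ᵐ y ∂unitExp, outDens b μ₁ y = outDens b μ₂ y) : μ₁ = μ₂ := by
  have h1 : outDens b μ₁ =ᵐ[volume.restrict (Set.Ioi 0)] outDens b μ₂ := by
    rw [Measure.restrict_congr_set Ioi_ae_eq_Ici]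
    exact volume_restrict_absolutelyContinuous_unitExp.ae_le h
  have h2 : Set.EqOn (outDens b μ₁) (outDens b μ₂) (Set.Ioi 0) :=
    Measure.eqOn_open_of_ae_eq h1 isOpen_Ioi (continuous_outDens hb.le μ₁).continuousOn
      (continuous_outDens hb.le μ₂).continuousOn
  -- The endpoint matters: the moment of order `0` is the density at `y = 0`.
  have h3 : Set.EqOn (outDens b μ₁) (outDens b μ₂) (Set.Ici 0) := by
    rw [← closure_Ioi]
    exact h2.closure (continuous_outDens hb.le μ₁) (continuous_outDens hb.le μ₂)
  exact eq_of_outDens_eq hb fun n => h3 (Set.mem_Ici.2 (Nat.cast_nonneg n))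

/-- The equal mixture of two input laws. -/
noncomputable def mid (μ₁ μ₂ : Measure ℝ≥0) : Measure ℝ≥0 :=
  ENNReal.ofReal (1 / 2) • μ₁ + ENNReal.ofReal (1 / 2) • μ₂

section Mid

variable {μ₁ μ₂ : Measure ℝ≥0}

instance [IsProbabilityMeasure μ₁] [IsProbabilityMeasure μ₂] :
    IsProbabilityMeasure (mid μ₁ μ₂) := by
  constructor
  rw [mid, Measure.add_apply, Measure.smul_apply, Measure.smul_apply, measure_univ, measure_univ,
    smul_eq_mul, mul_one, ← ENNReal.ofReal_add (by norm_num) (by norm_num)]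
  norm_num

theorem integrable_mid {f : ℝ≥0 → ℝ} (h₁ : Integrable f μ₁) (h₂ : Integrable f μ₂) :
    Integrable f (mid μ₁ μ₂) :=
  (h₁.smul_measure ENNReal.ofReal_ne_top).add_measure (h₂.smul_measure ENNReal.ofReal_ne_top)

theorem integral_mid {f : ℝ≥0 → ℝ} (h₁ : Integrable f μ₁) (h₂ : Integrable f μ₂) :
    ∫ x, f x ∂mid μ₁ μ₂ = 1 / 2 * ∫ x, f x ∂μ₁ + 1 / 2 * ∫ x, f x ∂μ₂ := by
  rw [mid, integral_add_measure (h₁.smul_measure ENNReal.ofReal_ne_top)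
    (h₂.smul_measure ENNReal.ofReal_ne_top), integral_smul_measure, integral_smul_measure,
    ENNReal.toReal_ofReal (by norm_num), smul_eq_mul, smul_eq_mul]

variable [IsProbabilityMeasure μ₁] [IsProbabilityMeasure μ₂]

theorem outDens_mid (hb : 0 ≤ b) (y : ℝ) :
    outDens b (mid μ₁ μ₂) y = 1 / 2 * outDens b μ₁ y + 1 / 2 * outDens b μ₂ y :=
  integral_mid (integrable_lik hb μ₁ y) (integrable_lik hb μ₂ y)

theorem klFun_outDens_mid_le (hb : 0 ≤ b) (y : ℝ) :
    klFun (outDens b (mid μ₁ μ₂) y)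
      ≤ 1 / 2 * klFun (outDens b μ₁ y) + 1 / 2 * klFun (outDens b μ₂ y) := by
  rw [outDens_mid hb]
  exact convexOn_klFun.2 (outDens_nonneg hb μ₁ y) (outDens_nonneg hb μ₂ y) (by norm_num)
    (by norm_num) (by norm_num)

theorem realDiv_mid_le (hb : 0 ≤ b) (h₁ : Integrable (fun x : ℝ≥0 => (x : ℝ)) μ₁)
    (h₂ : Integrable (fun x : ℝ≥0 => (x : ℝ)) μ₂) :
    realDiv b (mid μ₁ μ₂) ≤ 1 / 2 * realDiv b μ₁ + 1 / 2 * realDiv b μ₂ := by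
  have i₁ := (integrable_klFun_outDens hb h₁).const_mul (1 / 2)
  have i₂ := (integrable_klFun_outDens hb h₂).const_mul (1 / 2)
  unfold realDiv
  rw [← integral_const_mul, ← integral_const_mul, ← integral_add i₁ i₂]
  exact integral_mono (integrable_klFun_outDens hb (integrable_mid h₁ h₂)) (i₁.add i₂)
    fun y => klFun_outDens_mid_le hb y

/-- Equality of integrals forces equality almost everywhere in the pointwise convexity bound; strict
convexity of `klFun` then makes the output densities agree. -/
theorem eq_of_le_realDiv_mid (hb : 0 < b) (h₁ : Integrable (fun x : ℝ≥0 => (x : ℝ)) μ₁)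
    (h₂ : Integrable (fun x : ℝ≥0 => (x : ℝ)) μ₂)
    (h : 1 / 2 * realDiv b μ₁ + 1 / 2 * realDiv b μ₂ ≤ realDiv b (mid μ₁ μ₂)) : μ₁ = μ₂ := by
  have i₁ := (integrable_klFun_outDens hb.le h₁).const_mul (1 / 2)
  have i₂ := (integrable_klFun_outDens hb.le h₂).const_mul (1 / 2)
  have i := integrable_klFun_outDens hb.le (integrable_mid h₁ h₂)
  unfold realDiv at h
  rw [← integral_const_mul, ← integral_const_mul, ← integral_add i₁ i₂] at h
  have hle : (fun y => klFun (outDens b (mid μ₁ μ₂) y)) ≤ᵐ[unitExp]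
      fun y => 1 / 2 * klFun (outDens b μ₁ y) + 1 / 2 * klFun (outDens b μ₂ y) :=
    Eventually.of_forall fun y => klFun_outDens_mid_le hb.le y
  have heq := (integral_eq_iff_of_ae_le i (i₁.add i₂) hle).1
    (le_antisymm (integral_mono_ae i (i₁.add i₂) hle) h)
  refine eq_of_ae_outDens_eq hb ?_
  filter_upwards [heq] with y hy
  by_contra hne
  have := strictConvexOn_klFun.2 (outDens_nonneg hb.le μ₁ y) (outDens_nonneg hb.le μ₂ y) hne
    (show (0 : ℝ) < 1 / 2 by norm_num) (show (0 : ℝ) < 1 / 2 by norm_num) (by norm_num)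
  rw [outDens_mid hb.le] at hy
  exact this.ne hy

end Mid

/-- The midpoint is feasible by convexity and cannot beat either optimum; the linear part of the
information averages exactly, so no strict convexity gap is left. -/
theorem eq_of_isOptimalInput {θ ν : ℝ} (hθ : 0 < θ) (hν : 0 ≤ ν) {μ₁ μ₂ : Measure ℝ≥0}
    (h₁ : IsOptimalInput θ ν μ₁) (h₂ : IsOptimalInput θ ν μ₂) : μ₁ = μ₂ := by
  have hb : 0 < θ ^ 2 := by positivity
  obtain ⟨p₁, i₁, d₁⟩ := (mem_feasible_iff hν μ₁).1 h₁.1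
  obtain ⟨p₂, i₂, d₂⟩ := (mem_feasible_iff hν μ₂).1 h₂.1
  have hmid : mid μ₁ μ₂ ∈ feasible ν := by
    rw [mem_feasible_iff hν]
    refine ⟨inferInstance, integrable_mid i₁ i₂, ?_⟩
    linarith [realDiv_mid_le zero_le_one i₁ i₂]
  have e₁ := realInfo_le_of_isOptimalInput hν h₁ hmid
  have e₂ := realInfo_le_of_isOptimalInput hν h₂ hmid
  refine eq_of_le_realDiv_mid hb i₁ i₂ ?_
  unfold realInfo at e₁ e₂
  rw [integral_mid (integrable_expDiv hb.le i₁) (integrable_expDiv hb.le i₂)] at e₁ e₂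
  linarith

end CovertRayleigh

theorem mainTheorem6 (θ : ℝ) (hθ : 0 < θ) :
    ∃ ν₀ : ℝ, 0 < ν₀ ∧ ∀ ν : ℝ, 0 < ν → ν < ν₀ →
      ∃ μ : Measure ℝ≥0,
        CovertRayleigh.IsOptimalInput θ ν μ ∧
        (∀ μ' : Measure ℝ≥0, CovertRayleigh.IsOptimalInput θ ν μ' → μ' = μ) ∧
        0 < μ {0} := by
  obtain ⟨ν₀, hν₀, h⟩ := CovertRayleigh.exists_forall_zero_lt_measure_singleton_zero hθ
  refine ⟨ν₀, hν₀, fun ν hν hlt => ?_⟩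
  obtain ⟨μ, hμ⟩ := CovertRayleigh.exists_isOptimalInput θ hν.le
  exact ⟨μ, hμ, fun μ' hμ' => CovertRayleigh.eq_of_isOptimalInput hθ hν.le hμ' hμ,
    h ν hν hlt μ hμ⟩
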